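/- **Setting.** Let $\mathbb H^{2n+1}=\{(x,y,z):x,y\in\mathbb R^n,\ z\in\mathbb R\}$ with $(x^1,y^1,z^1)\cdot(x^2,y^2,z^2)=\bigl(x^1+x^2,\,y^1+y^2,\,z^1+z^2+\tfrac12(\langle x^1,y^2\rangle-\langle x^2,y^1\rangle)\bigr)$. For a set $U\subset\mathbb R^n\times\mathbb R^n$ (horizontal velocities at the identity) consider the time-minimization problem $T\to\min$, $\dot q(t)\in q(t)U$, $q(0)=(0,0,0)$, $q(T)=q_1$, i.e. $(\dot x,\dot y)\in U$ and $\dot z=\frac12\sum_i(x_i\dot y_i-y_i\dot x_i)$. An *extremal* on $[0,T]$, $T>0$, is a Lipschitz curve $q=(x,y,z)$ starting at the identity, generated by a measurable $U$-valued control, that satisfies the Pontryagin maximum principle: there is a nowhere vanishing Lipschitz curve of covectors that solves the adjoint Hamiltonian equation and for which, at a.e. $t$, the control maximizes over $U$ the Pontryagin function $H(q,p,(u,v))=\sum_i(\varphi_iu_i+\psi_iv_i)+\frac\zeta2\sum_i(x_iv_i-y_iu_i)$, $p=(\varphi,\psi,\zeta)$. **Assumption.** There are compact convex sets $\Omega_1,\dots,\Omega_n\subset\mathbb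 R^2$ with $0\in\operatorname{int}\Omega_i$ and a continuous, convex, positively homogeneous function $\mu:\mathbb R^n_+\to\mathbb R_+$, non-decreasing in each argument and strictly positive outside the origin, such that $U=\{(u,v):\mu(\mu_{\Omega_1}(u_1,v_1),\dots,\mu_{\Omega_n}(u_n,v_n))\le1\}$, where $\mu_\Omega$ is the Minkowski functional of $\Omega$. **Notation.** For a compact convex $\Omega\subset\mathbb R^2$ with $0\in\operatorname{int}\Omega$ and area $\mathbb S$, and for $0\le\theta<2\mathbb S$, $(\cos_\Omega\theta,\sin_\Omega\theta)$ is the point $P_\theta\in\partial\Omega$ for which the sector of $\Omega$ counterclockwise from the ray $Ox$ to the ray $OP_\theta$ has area $\theta/2$; $\cos_\Omega$ and $\sin_\Omega$ are extended $2\mathbb S$-periodically to $\mathbb R$. Let $\Omega^\circ=\{(p,q):px+qy\le1\ \forall(x,y)\in\Omega\}$. Write $\theta\xleftrightarrow{\Omega}\theta^\circ$ if the covector $(\cos_{\Omega^\circ}\theta^\circ,\sin_{\Omega^\circ}\theta^\circ)$ determines a supporting half-plane of $\Omega$ at $(\cos_\Omega\theta,\sin_\Omega\theta)$. Let $\Xi=\{\lambda\in\mathbb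 R^n_+:\mu(\lambda)\le1\}$, let $s_\Xi$ be its support function and $\partial s_\Xi$ the subdifferential of $s_\Xi$. **Theorem.** Under the assumption, a curve $(x(t),y(t),z(t))$, $t\in[0,T]$, is an extremal if and only if there exist constants $\gamma\in\{0,1,-1\}$ and $A\in\mathbb R^n_+$ that do not vanish simultaneously, constants $\theta^\circ_{i0}\in\mathbb R$ for each $i$ with $A_i>0$, and a measurable function $\lambda(t)=(\lambda_1(t),\dots,\lambda_n(t))\in\partial s_\Xi(A)$ such that $\lambda_i\equiv0$ whenever $A_i=0$ and $\gamma\ne0$, with the following properties. 1. If $\gamma\ne0$, then for each $i$ with $A_i>0$ $$x_i=\gamma A_i(\sin_{\Omega_i^\circ}\theta_i^\circ-\sin_{\Omega_i^\circ}\theta_{i0}^\circ),\qquad y_i=\gamma A_i(\cos_{\Omega_i^\circ}\theta_{i0}^\circ-\cos_{\Omega_i^\circ}\theta_i^\circ),\qquad \theta_i^\circ(t)=\theta_{i0}^\circ+\frac{\gamma}{A_i}\int_0^t\lambda_i(\tau)\,d\tau;$$ for each $i$ with $A_i=0$, $x_i\equiv y_i\equiv0$; and $$2z=\gamma s_\Xi(A)\,t+\sum_{i:A_i>0}A_i^2\bigl(\sin_{\Omega_i^\circ}\theta_{i0}^\circ\cos_{\Omega_i^\circ}\theta_i^\circ-\cos_{\Omega_i^\circ}\theta_{i0}^\circ\sin_{\Omega_i^\circ}\theta_i^\circ\bigr).$$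 2. If $\gamma=0$, then there are measurable functions $\theta_i(t)$, with $\theta_i(t)\xleftrightarrow{\Omega_i}\theta_{i0}^\circ$ for all $t$ if $A_i>0$ and $\theta_i$ arbitrary if $A_i=0$, such that for each $i$ $$x_i(t)=\int_0^t\lambda_i(\tau)\cos_{\Omega_i}\theta_i(\tau)\,d\tau,\qquad y_i(t)=\int_0^t\lambda_i(\tau)\sin_{\Omega_i}\theta_i(\tau)\,d\tau,$$ and $z(t)=\frac12\int_0^t\sum_i\bigl(x_i(\tau)\dot y_i(\tau)-\dot x_i(\tau)y_i(\tau)\bigr)\,d\tau$. -/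

import Mathlib

open MeasureTheory Set

noncomputable section

namespace SubFinsler

/-! ### Convex trigonometry in the plane -/

/-- The (one-sided) polar set `{(p, q) | p x + q y ≤ 1 for all (x, y) ∈ Ω}`. -/
def polarSet (Ω : Set (ℝ × ℝ)) : Set (ℝ × ℝ) :=
  {Q | ∀ P ∈ Ω, Q.1 * P.1 + Q.2 * P.2 ≤ 1}

/-- The area of a plane set. -/
def area (Ω : Set (ℝ × ℝ)) : ℝ := (volume Ω).toReal

/-- The part of `Ω` between the ray `Ox` and the ray with (Euclidean) polar angle `α`,
counted counterclockwise. -/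
def sector (Ω : Set (ℝ × ℝ)) (α : ℝ) : Set (ℝ × ℝ) :=
  {P | P ∈ Ω ∧ ∃ r : ℝ, 0 ≤ r ∧ ∃ β ∈ Icc (0 : ℝ) α, P = (r * Real.cos β, r * Real.sin β)}

/-- `P` is the boundary point of `Ω` with generalized angle `θ`: after a shift of `θ` by a multiple
of twice the area of `Ω`, the sector of `Ω` between `Ox` and `OP` has area `θ / 2`. -/
def IsAnglePoint (Ω : Set (ℝ × ℝ)) (θ : ℝ) (P : ℝ × ℝ) : Prop :=
  P ∈ frontier Ω ∧
    ∃ α ∈ Ico (0 : ℝ) (2 * Real.pi), ∃ r : ℝ, 0 < r ∧ P = (r * Real.cos α, r * Real.sin α) ∧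
      ∃ k : ℤ, area (sector Ω α) = (θ + 2 * area Ω * k) / 2

/-- The boundary point `P_θ` of `Ω` (it exists and is unique when `Ω` is a compact convex set with
the origin in its interior). -/
def anglePoint (Ω : Set (ℝ × ℝ)) (θ : ℝ) : ℝ × ℝ :=
  Classical.epsilon (IsAnglePoint Ω θ)

/-- The generalized cosine `cos_Ω`. -/
def cosOf (Ω : Set (ℝ × ℝ)) (θ : ℝ) : ℝ := (anglePoint Ω θ).1

/-- The generalized sine `sin_Ω`. -/
def sinOf (Ω : Set (ℝ × ℝ)) (θ : ℝ) : ℝ := (anglePoint Ω θ).2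

/-- The correspondence between an angle `θ` of `Ω` and an angle `θ'` of the polar set: the covector
`(cos θ', sin θ')` (trigonometry of the polar set) determines a supporting half-plane of `Ω` at
the boundary point with angle `θ`. -/
def Corresponds (Ω : Set (ℝ × ℝ)) (θ θ' : ℝ) : Prop :=
  ∀ P ∈ Ω, cosOf (polarSet Ω) θ' * P.1 + sinOf (polarSet Ω) θ' * P.2 ≤
    cosOf (polarSet Ω) θ' * cosOf Ω θ + sinOf (polarSet Ω) θ' * sinOf Ω θ

/-! ### Support functions and subdifferentials -/

variable {n : ℕ}

/-- The support function of a subset of `ℝⁿ`. -/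
def supportFun (X : Set (Fin n → ℝ)) (A : Fin n → ℝ) : ℝ :=
  sSup ((fun l : Fin n → ℝ => ∑ i, A i * l i) '' X)

/-- The subdifferential of `s : ℝⁿ → ℝ` at `A`. -/
def subdiff (s : (Fin n → ℝ) → ℝ) (A : Fin n → ℝ) : Set (Fin n → ℝ) :=
  {l | ∀ B : Fin n → ℝ, s A + ∑ i, l i * (B i - A i) ≤ s B}

/-- The set `Ξ = {l ∈ ℝⁿ₊ | μ l ≤ 1}`. -/
def xiSet (μ : (Fin n → ℝ) → ℝ) : Set (Fin n → ℝ) :=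
  {l | (∀ i, 0 ≤ l i) ∧ μ l ≤ 1}

/-! ### The Heisenberg group and its left-invariant problems -/

/-- The underlying space of the Heisenberg group: triples `(x, y, z)`. The same space of triples
`(φ, ψ, ζ)` is used for covectors. -/
abbrev Heis (n : ℕ) : Type := (Fin n → ℝ) × (Fin n → ℝ) × ℝ

/-- Horizontal vectors `(ẋ, ẏ)` at the identity. -/
abbrev HVec (n : ℕ) : Type := (Fin n → ℝ) × (Fin n → ℝ)

/-- The multiplication of the Heisenberg group. Its identity is `(0, 0, 0)`. -/
def heisMul (q r : Heis n) : Heis n :=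
  (q.1 + r.1, q.2.1 + r.2.1,
    q.2.2 + r.2.2 + (1 / 2) * (∑ i, q.1 i * r.2.1 i - ∑ i, r.1 i * q.2.1 i))

/-- The left translate to `q` of the horizontal vector `w` at the identity. -/
def leftVelocity (q : Heis n) (w : HVec n) : Heis n :=
  (w.1, w.2, (1 / 2) * ∑ i, (q.1 i * w.2 i - q.2.1 i * w.1 i))

/-- `leftVelocity` is the differential of the left translation by `q` at the identity, applied
to the horizontal vector `w`. -/
theorem hasDerivAt_heisMul (q : Heis n) (w : HVec n) :
    HasDerivAt (fun s : ℝ => heisMul q (s • ((w.1, w.2, 0) : Heis n))) (leftVelocity q w) 0 := by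
  have h : (fun s : ℝ => heisMul q (s • ((w.1, w.2, 0) : Heis n))) =
      fun s : ℝ => q + s • leftVelocity q w := by
    funext s
    refine Prod.ext rfl (Prod.ext rfl ?_)
    simp only [heisMul, leftVelocity, Prod.smul_mk, Prod.snd_add, Pi.smul_apply, smul_eq_mul,
      Finset.sum_sub_distrib, mul_zero, add_zero]
    have h1 : ∑ i, q.1 i * (s * w.2 i) = s * ∑ i, q.1 i * w.2 i := by
      rw [Finset.mul_sum]; exact Finset.sum_congr rfl fun i _ => by ring
    have h2 : ∑ i, s * w.1 i * q.2.1 i = s * ∑ i, q.2.1 i * w.1 i := by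
      rw [Finset.mul_sum]; exact Finset.sum_congr rfl fun i _ => by ring
    rw [h1, h2]; ring
  rw [h]
  simpa using ((hasDerivAt_id (0 : ℝ)).smul_const (leftVelocity q w)).const_add q

/-- The pairing of a covector and a vector. -/
def pairing (p v : Heis n) : ℝ :=
  ∑ i, p.1 i * v.1 i + ∑ i, p.2.1 i * v.2.1 i + p.2.2 * v.2.2

/-- The Pontryagin function (Hamiltonian) of the time-minimization problem. -/
def pontryagin (q p : Heis n) (w : HVec n) : ℝ := pairing p (leftVelocity q w)

/-- The right-hand side `- ∂H/∂q` of the adjoint equation. -/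
def adjointVelocity (p : Heis n) (w : HVec n) : Heis n :=
  (fun i => -(p.2.2 / 2 * w.2 i), fun i => p.2.2 / 2 * w.1 i, 0)

/-- `adjointVelocity` is minus the derivative of the Hamiltonian in the base point. -/
theorem hasDerivAt_pontryagin (q p v : Heis n) (w : HVec n) :
    HasDerivAt (fun s : ℝ => pontryagin (q + s • v) p w) (-pairing (adjointVelocity p w) v) 0 := by
  have h : (fun s : ℝ => pontryagin (q + s • v) p w) =
      fun s : ℝ => pontryagin q p w + s * (-pairing (adjointVelocity p w) v) := by
    funext s
    simp only [pontryagin, pairing, leftVelocity, adjointVelocity, Prod.fst_add, Prod.snd_add,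
      Prod.smul_fst, Prod.smul_snd, Pi.add_apply, Pi.smul_apply, smul_eq_mul,
      Finset.sum_sub_distrib, add_mul, Finset.sum_add_distrib, neg_mul, Finset.sum_neg_distrib]
    have h1 : ∑ i, s * v.1 i * w.2 i = s * ∑ i, v.1 i * w.2 i := by
      rw [Finset.mul_sum]; exact Finset.sum_congr rfl fun i _ => by ring
    have h2 : ∑ i, s * v.2.1 i * w.1 i = s * ∑ i, v.2.1 i * w.1 i := by
      rw [Finset.mul_sum]; exact Finset.sum_congr rfl fun i _ => by ring
    have h3 : ∑ i, p.2.2 / 2 * w.2 i * v.1 i = p.2.2 / 2 * ∑ i, v.1 i * w.2 i := by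
      rw [Finset.mul_sum]; exact Finset.sum_congr rfl fun i _ => by ring
    have h4 : ∑ i, p.2.2 / 2 * w.1 i * v.2.1 i = p.2.2 / 2 * ∑ i, v.2.1 i * w.1 i := by
      rw [Finset.mul_sum]; exact Finset.sum_congr rfl fun i _ => by ring
    rw [h1, h2, h3, h4]; ring
  rw [h]
  simpa using ((hasDerivAt_id (0 : ℝ)).mul_const
    (-pairing (adjointVelocity p w) v)).const_add (pontryagin q p w)

/-- `q` is an extremal on `[0, T]` of the problem `T → min`, `q̇ ∈ q U`, `q 0 = 1`: a Lipschitz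
curve generated by a measurable control with values in `U`, with a nowhere vanishing Lipschitz
curve of covectors that solves the adjoint equation and along which, at almost every instant, the
control maximizes the Hamiltonian over `U`. (The maximum is nonnegative whenever `0 ∈ U`.) -/
def IsExtremal (U : Set (HVec n)) (T : ℝ) (q : ℝ → Heis n) : Prop :=
  q 0 = 0 ∧
  ∃ (w : ℝ → HVec n) (p : ℝ → Heis n),
    Measurable w ∧ (∀ t ∈ Icc 0 T, w t ∈ U) ∧
    (∃ K, LipschitzOnWith K q (Icc 0 T)) ∧ (∃ K, LipschitzOnWith K p (Icc 0 T)) ∧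
    (∀ t ∈ Icc 0 T, p t ≠ 0) ∧
    ∀ᵐ t ∂(volume.restrict (Icc 0 T)),
      HasDerivAt q (leftVelocity (q t) (w t)) t ∧
      HasDerivAt p (adjointVelocity (p t) (w t)) t ∧
      ∀ w' ∈ U, pontryagin (q t) (p t) w' ≤ pontryagin (q t) (p t) (w t)

/-- The set `U` of unit velocities admits generalized spherical coordinates, given by plane sets
`Ω i` and a function `μ` on the nonnegative orthant (values of `μ` elsewhere are irrelevant). -/
structure SphericalForm (U : Set (HVec n)) (Ω : Fin n → Set (ℝ × ℝ))
    (μ : (Fin n → ℝ) → ℝ) : Prop where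
  isCompact : ∀ i, IsCompact (Ω i)
  convex : ∀ i, Convex ℝ (Ω i)
  zero_mem : ∀ i, (0 : ℝ × ℝ) ∈ interior (Ω i)
  continuousOn : ContinuousOn μ {l | ∀ i, 0 ≤ l i}
  convexOn : ConvexOn ℝ {l | ∀ i, 0 ≤ l i} μ
  homogeneous : ∀ c : ℝ, 0 < c → ∀ l : Fin n → ℝ, (∀ i, 0 ≤ l i) → μ (c • l) = c * μ l
  monotoneOn : MonotoneOn μ {l | ∀ i, 0 ≤ l i}
  pos : ∀ l : Fin n → ℝ, (∀ i, 0 ≤ l i) → l ≠ 0 → 0 < μ l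
  eq_setOf : U = {w | μ (fun i => gauge (Ω i) (w.1 i, w.2 i)) ≤ 1}

/-- The angles `θ_i°(t) = θ_{i0}° + (γ / A_i) ∫₀ᵗ l_i` (used for `A_i > 0`). -/
def polarAngle (γ : ℝ) (A θ₀ : Fin n → ℝ) (l : ℝ → Fin n → ℝ) (i : Fin n) (t : ℝ) : ℝ :=
  θ₀ i + γ / A i * ∫ τ in (0 : ℝ)..t, l τ i

end SubFinsler

end

open SubFinsler

open scoped Topology NNReal

namespace SubFinsler


/-! ### Lipschitz functions on an interval -/

/-! The vertical covector ζ is constant, and the Pontryagin function sees the control only through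
h_i = φ_i − ζ y_i/2 and g_i = ψ_i + ζ x_i/2. Rescaling the covector turns ζ into γ ∈ {0, 1, −1}.
With (u, v) the velocity, h_i' = −γ v_i and g_i' = γ u_i. So for γ ≠ 0 the curve is read off the
covector: x = γ(g − g(0)), y = γ(h(0) − h).

Let A_i be the gauge of (h_i, g_i) in the polar of Ω_i, and λ_i the gauge of (u_i, v_i) in Ω_i.
Planar polar duality gives Σ(h_i u_i + g_i v_i) ≤ Σ A_i λ_i ≤ s_Ξ(A), and the last value is attained
on U. The maximum condition is therefore equality throughout: λ ∈ ∂s_Ξ(A), and every planar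
component is extremal for the duality (`SphericalForm.isMax_iff`). Since (h_i', g_i') is orthogonal
to (u_i, v_i), each A_i is conserved (`NormalizedExtremal.polarGauges_eq`).

Hence (h_i, g_i)/A_i runs on the boundary of the polar body. The generalized angle is twice a swept
area, so its rate is the cross product of point and velocity. Here h_i g_i' − g_i h_i' = γ A_i λ_i,
so the angle has rate γ λ_i/A_i (`PlaneBody.anglePoint_eq_of_cross_deriv`). Conversely, the velocity
of a boundary curve of the polar body is the cross product times a rotated support point
(`PlaneBody.deriv_eq_of_support`), which gives back the Hamiltonian equations. For γ = 0 the
covector is constant and only the duality condition remains. The formula for z follows by comparing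
derivatives.

No smoothness or strict convexity is available. Derivatives exist almost everywhere only; Lipschitz
functions are identified by their a.e. derivatives, and gauges are differentiated by touching them
with a linear function at a support point. -/

/-- `f` is Lipschitz on `[0, T]`. -/
def LipOn {E : Type*} [PseudoEMetricSpace E] (T : ℝ) (f : ℝ → E) : Prop :=
  ∃ K : ℝ≥0, LipschitzOnWith K f (Icc 0 T)

namespace LipOn

variable {T : ℝ}

theorem continuousOn {E : Type*} [PseudoEMetricSpace E] {f : ℝ → E} (hf : LipOn T f) :
    ContinuousOn f (Icc 0 T) := by
  obtain ⟨K, hK⟩ := hf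
  exact hK.continuousOn

theorem congr {E : Type*} [PseudoEMetricSpace E] {f g : ℝ → E} (hf : LipOn T f)
    (h : ∀ t ∈ Icc 0 T, g t = f t) : LipOn T g := by
  obtain ⟨K, hK⟩ := hf
  refine ⟨K, fun s hs t ht => ?_⟩
  rw [h s hs, h t ht]
  exact hK hs ht

theorem const {E : Type*} [PseudoEMetricSpace E] (c : E) : LipOn T fun _ : ℝ => c :=
  ⟨0, fun s _ t _ => by simp⟩

theorem id : LipOn T fun t : ℝ => t :=
  ⟨1, LipschitzWith.id.lipschitzOnWith⟩

theorem lipschitz_comp {E F : Type*} [PseudoEMetricSpace E] [PseudoEMetricSpace F] {K : ℝ≥0}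
    {φ : E → F} (hφ : LipschitzWith K φ) {f : ℝ → E} (hf : LipOn T f) :
    LipOn T fun t => φ (f t) := by
  obtain ⟨C, hC⟩ := hf
  exact ⟨K * C, hφ.comp_lipschitzOnWith hC⟩

theorem prodMk {E F : Type*} [PseudoEMetricSpace E] [PseudoEMetricSpace F] {f : ℝ → E}
    {g : ℝ → F} (hf : LipOn T f) (hg : LipOn T g) : LipOn T fun t => (f t, g t) := by
  obtain ⟨C, hC⟩ := hf
  obtain ⟨D, hD⟩ := hg
  exact ⟨max C D, hC.prodMk hD⟩

/-- A locally Lipschitz function on a compact interval is Lipschitz. Smoothness is asked only along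
the curve, so inverses and square roots away from zero are allowed. -/
theorem contDiff_comp {E F : Type*} [NormedAddCommGroup E] [NormedSpace ℝ E]
    [NormedAddCommGroup F] [NormedSpace ℝ F] {φ : E → F} {f : ℝ → E} (hf : LipOn T f)
    (hφ : ∀ t ∈ Icc 0 T, ContDiffAt ℝ 1 φ (f t)) : LipOn T fun t => φ (f t) := by
  have hloc : LocallyLipschitzOn (Icc 0 T) fun t => φ (f t) := by
    intro t ht
    obtain ⟨K, s, hs, hK⟩ := (hφ t ht).exists_lipschitzOnWith
    obtain ⟨C, hC⟩ := hf
    refine ⟨K * C, Icc 0 T ∩ f ⁻¹' s, ?_, ?_⟩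
    · exact Filter.inter_mem self_mem_nhdsWithin (hC.continuousOn t ht hs)
    · exact hK.comp (hC.mono inter_subset_left) fun u hu => hu.2
  exact hloc.exists_lipschitzOnWith_of_compact isCompact_Icc

theorem add {f g : ℝ → ℝ} (hf : LipOn T f) (hg : LipOn T g) : LipOn T fun t => f t + g t := by
  obtain ⟨C, hC⟩ := hf
  obtain ⟨D, hD⟩ := hg
  exact ⟨C + D, hC.add hD⟩

theorem mul {f g : ℝ → ℝ} (hf : LipOn T f) (hg : LipOn T g) : LipOn T fun t => f t * g t :=
  (hf.prodMk hg).contDiff_comp (φ := fun p : ℝ × ℝ => p.1 * p.2) fun t _ => by fun_prop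

theorem const_mul {f : ℝ → ℝ} (c : ℝ) (hf : LipOn T f) : LipOn T fun t => c * f t :=
  (LipOn.const c).mul hf

theorem neg {f : ℝ → ℝ} (hf : LipOn T f) : LipOn T fun t => -f t :=
  (hf.const_mul (-1)).congr fun t _ => by ring

theorem sub {f g : ℝ → ℝ} (hf : LipOn T f) (hg : LipOn T g) : LipOn T fun t => f t - g t :=
  (hf.add hg.neg).congr fun t _ => by ring

theorem sum {ι : Type*} (s : Finset ι) {f : ι → ℝ → ℝ} (hf : ∀ i, LipOn T (f i)) :
    LipOn T fun t => ∑ i ∈ s, f i t := by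
  classical
  induction s using Finset.induction_on with
  | empty => exact (LipOn.const (0 : ℝ)).congr fun t _ => by simp
  | insert a s ha ih => exact ((hf a).add ih).congr fun t _ => by rw [Finset.sum_insert ha]

theorem pi {ι : Type*} [Fintype ι] {f : ℝ → ι → ℝ} (hf : ∀ i, LipOn T fun t => f t i) :
    LipOn T f := by
  choose K hK using hf
  refine ⟨∑ i, K i, fun s hs t ht => ?_⟩
  rw [edist_pi_def, Finset.sup_le_iff]
  intro i _
  refine (hK i hs ht).trans ?_
  gcongr
  exact Finset.single_le_sum (f := K) (fun _ _ => zero_le) (Finset.mem_univ i)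

theorem absolutelyContinuous {f : ℝ → ℝ} (hT : 0 ≤ T) (hf : LipOn T f) :
    AbsolutelyContinuousOnInterval f 0 T := by
  obtain ⟨K, hK⟩ := hf
  rw [← uIcc_of_le hT] at hK
  exact hK.absolutelyContinuousOnInterval

theorem ae_differentiableAt {f : ℝ → ℝ} (hT : 0 ≤ T) (hf : LipOn T f) :
    ∀ᵐ t ∂(volume.restrict (Icc 0 T)), DifferentiableAt ℝ f t := by
  rw [ae_restrict_iff' measurableSet_Icc, ← uIcc_of_le hT]
  exact (hf.absolutelyContinuous hT).ae_differentiableAt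

/-- Absolute continuity makes an a.e. vanishing derivative sufficient. All conserved quantities
below are obtained from this lemma. -/
theorem eq_of_ae_hasDerivAt_zero {f : ℝ → ℝ} (hT : 0 ≤ T) (hf : LipOn T f)
    (h : ∀ᵐ t ∂(volume.restrict (Icc 0 T)), HasDerivAt f 0 t) : ∀ t ∈ Icc 0 T, f t = f 0 := by
  rw [ae_restrict_iff' measurableSet_Icc, ← uIcc_of_le hT] at h
  obtain ⟨C, hC⟩ := (hf.absolutelyContinuous hT).const_of_ae_hasDerivAt_zero h
  rw [uIcc_of_le hT] at hC
  intro t ht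
  rw [hC t ht, hC 0 ⟨le_rfl, hT⟩]

theorem eq_of_ae_hasDerivAt {f g : ℝ → ℝ} {f' : ℝ → ℝ} (hT : 0 ≤ T) (hf : LipOn T f)
    (hg : LipOn T g) (h0 : f 0 = g 0)
    (h : ∀ᵐ t ∂(volume.restrict (Icc 0 T)), HasDerivAt f (f' t) t ∧ HasDerivAt g (f' t) t) :
    ∀ t ∈ Icc 0 T, f t = g t := by
  have := (hf.sub hg).eq_of_ae_hasDerivAt_zero hT (by
    filter_upwards [h] with t ht
    simpa using ht.1.fun_sub ht.2)
  intro t ht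
  have := this t ht
  linarith

end LipOn

/-! ### Almost every instant, and primitives of bounded measurable functions -/

theorem ae_mem_Ioo (T : ℝ) : ∀ᵐ t ∂(volume.restrict (Icc 0 T)), t ∈ Ioo 0 T := by
  rw [Measure.restrict_congr_set (Ioo_ae_eq_Icc (α := ℝ) (μ := volume)).symm]
  exact ae_restrict_mem measurableSet_Ioo

/-- Identities hold only on the closed interval, while derivatives are two-sided; interior points,
which are almost all, reconcile the two. -/
theorem hasDerivAt_congr_Icc {E : Type*} [NormedAddCommGroup E] [NormedSpace ℝ E] {T t : ℝ}
    {f g : ℝ → E} {f' : E} (ht : t ∈ Ioo 0 T) (h : ∀ s ∈ Icc 0 T, g s = f s)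
    (hf : HasDerivAt f f' t) : HasDerivAt g f' t :=
  hf.congr_of_eventuallyEq (Filter.eventually_of_mem (Icc_mem_nhds ht.1 ht.2) h)

theorem intervalIntegrable_of_bounded {T C : ℝ} {l : ℝ → ℝ} (hl : Measurable l)
    (hC : ∀ t ∈ Icc 0 T, |l t| ≤ C) {s t : ℝ} (hs : s ∈ Icc 0 T) (ht : t ∈ Icc 0 T) :
    IntervalIntegrable l volume s t := by
  rw [intervalIntegrable_iff]
  refine Measure.integrableOn_of_bounded (M := C) (by simp) hl.aestronglyMeasurable ?_
  filter_upwards [ae_restrict_mem measurableSet_uIoc] with u hu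
  exact hC u (ordConnected_Icc.uIcc_subset hs ht (uIoc_subset_uIcc hu))

theorem LipOn.integral {T C : ℝ} {l : ℝ → ℝ} (hT : 0 ≤ T) (hl : Measurable l)
    (hC : ∀ t ∈ Icc 0 T, |l t| ≤ C) : LipOn T fun t => ∫ τ in (0 : ℝ)..t, l τ := by
  refine ⟨C.toNNReal, LipschitzOnWith.of_dist_le_mul fun s hs t ht => ?_⟩
  have h0 : (0 : ℝ) ∈ Icc 0 T := ⟨le_rfl, hT⟩
  rw [dist_comm, Real.dist_eq, intervalIntegral.integral_interval_sub_left
    (intervalIntegrable_of_bounded hl hC h0 ht) (intervalIntegrable_of_bounded hl hC h0 hs),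
    Real.coe_toNNReal _ ((abs_nonneg _).trans (hC 0 h0)), dist_comm, Real.dist_eq]
  exact intervalIntegral.norm_integral_le_of_norm_le_const (f := l) fun u hu =>
    hC u (ordConnected_Icc.uIcc_subset hs ht (uIoc_subset_uIcc hu))

theorem ae_hasDerivAt_integral {T C : ℝ} {l : ℝ → ℝ} (hT : 0 ≤ T) (hl : Measurable l)
    (hC : ∀ t ∈ Icc 0 T, |l t| ≤ C) :
    ∀ᵐ t ∂(volume.restrict (Icc 0 T)), HasDerivAt (fun t => ∫ τ in (0 : ℝ)..t, l τ) (l t) t := by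
  have h0 : (0 : ℝ) ∈ Icc 0 T := ⟨le_rfl, hT⟩
  have h := (intervalIntegrable_of_bounded hl hC h0 ⟨hT, le_rfl⟩).ae_hasDerivAt_integral
  rw [uIcc_of_le hT] at h
  rw [ae_restrict_iff' measurableSet_Icc]
  filter_upwards [h] with t h1 h2 using h1 h2 0 h0

theorem LipOn.integral_eq_sub {T : ℝ} {f f' : ℝ → ℝ} (hf : LipOn T f)
    (h : ∀ᵐ t ∂(volume.restrict (Icc 0 T)), HasDerivAt f (f' t) t) :
    ∀ t ∈ Icc 0 T, ∫ τ in (0 : ℝ)..t, f' τ = f t - f 0 := by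
  intro t ht
  obtain ⟨K, hK⟩ := hf
  have hft : LipOn t f := ⟨K, hK.mono (Icc_subset_Icc_right ht.2)⟩
  rw [← (hft.absolutelyContinuous ht.1).integral_deriv_eq_sub]
  rw [ae_restrict_iff' measurableSet_Icc] at h
  refine intervalIntegral.integral_congr_ae ?_
  filter_upwards [h] with s hs hst
  rw [uIoc_of_le ht.1] at hst
  exact (hs ⟨hst.1.le, hst.2.trans ht.2⟩).deriv.symm


/-! ### Planar convex bodies in polar coordinates -/

/-- A compact convex subset of the plane with the origin in its interior. -/
structure PlaneBody (K : Set (ℝ × ℝ)) : Prop where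
  isCompact : IsCompact K
  convex : Convex ℝ K
  zero_mem : (0 : ℝ × ℝ) ∈ interior K

/-- The unit vector with polar angle `α`. -/
noncomputable def unitVec (α : ℝ) : ℝ × ℝ := (Real.cos α, Real.sin α)

/-- The Euclidean radius of `K` in the direction `α`. -/
noncomputable def radius (K : Set (ℝ × ℝ)) (α : ℝ) : ℝ := (gauge K (unitVec α))⁻¹

/-- The boundary point of `K` in the direction `α`. -/
noncomputable def bdryPoint (K : Set (ℝ × ℝ)) (α : ℝ) : ℝ × ℝ := radius K α • unitVec α

/-- Twice the (signed) area swept out by the radius from direction `0` to direction `α`. -/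
noncomputable def sweep (K : Set (ℝ × ℝ)) (α : ℝ) : ℝ := ∫ β in (0 : ℝ)..α, radius K β ^ 2

theorem unitVec_ne_zero (α : ℝ) : unitVec α ≠ 0 := by
  intro h
  have h1 : Real.cos α = 0 := congrArg Prod.fst h
  have h2 : Real.sin α = 0 := congrArg Prod.snd h
  have := Real.cos_sq_add_sin_sq α
  rw [h1, h2] at this
  norm_num at this

theorem continuous_unitVec : Continuous unitVec := by
  unfold unitVec; fun_prop

theorem unitVec_add_two_pi (α : ℝ) : unitVec (α + 2 * Real.pi) = unitVec α := by
  simp [unitVec]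

theorem unitVec_add_int_mul (α : ℝ) (k : ℤ) : unitVec (α + k * (2 * Real.pi)) = unitVec α := by
  simp [unitVec]

theorem norm_unitVec_le (α : ℝ) : ‖unitVec α‖ ≤ 1 := by
  rw [unitVec, Prod.norm_def]
  exact max_le (Real.abs_cos_le_one α) (Real.abs_sin_le_one α)

theorem exists_eq_smul_unitVec {P : ℝ × ℝ} (hP : P ≠ 0) :
    0 < Real.sqrt (P.1 ^ 2 + P.2 ^ 2) ∧
      P = Real.sqrt (P.1 ^ 2 + P.2 ^ 2) • unitVec (Complex.arg ⟨P.1, P.2⟩) := by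
  have hz : (⟨P.1, P.2⟩ : ℂ) ≠ 0 := by
    intro h
    exact hP (Prod.ext (congrArg Complex.re h) (congrArg Complex.im h))
  have hn : ‖(⟨P.1, P.2⟩ : ℂ)‖ = Real.sqrt (P.1 ^ 2 + P.2 ^ 2) := by
    rw [Complex.norm_def, Complex.normSq_apply]
    congr 1; ring
  have hpos := norm_pos_iff.2 hz
  rw [hn] at hpos
  refine ⟨hpos, Prod.ext ?_ ?_⟩
  · simp only [unitVec, Prod.smul_fst, smul_eq_mul]
    rw [← hn, Complex.norm_mul_cos_arg]
  · simp only [unitVec, Prod.smul_snd, smul_eq_mul]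
    rw [← hn, Complex.norm_mul_sin_arg]

theorem eq_of_smul_unitVec_eq {r s α β : ℝ} (hr : 0 < r) (hs : 0 < s)
    (h : r • unitVec α = s • unitVec β) : ∃ k : ℤ, α = β + k * (2 * Real.pi) := by
  have h1 : r * Real.cos α = s * Real.cos β := congrArg Prod.fst h
  have h2 : r * Real.sin α = s * Real.sin β := congrArg Prod.snd h
  have hrs : r = s := by
    have e1 := Real.cos_sq_add_sin_sq α
    have e2 := Real.cos_sq_add_sin_sq β
    have : r ^ 2 = s ^ 2 := by
      calc r ^ 2 = (r * Real.cos α) ^ 2 + (r * Real.sin α) ^ 2 := by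
            linear_combination -r ^ 2 * e1
        _ = s ^ 2 := by rw [h1, h2]; linear_combination s ^ 2 * e2
    exact (pow_left_inj₀ hr.le hs.le two_ne_zero).1 this
  subst hrs
  obtain ⟨k, hk⟩ := Real.Angle.angle_eq_iff_two_pi_dvd_sub.1
    (Real.Angle.cos_sin_inj (mul_left_cancel₀ hr.ne' h1) (mul_left_cancel₀ hr.ne' h2))
  exact ⟨k, by linarith⟩

namespace PlaneBody

variable {K : Set (ℝ × ℝ)} (hK : PlaneBody K)
include hK

theorem mem_nhds : K ∈ 𝓝 (0 : ℝ × ℝ) := mem_interior_iff_mem_nhds.1 hK.zero_mem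

theorem gauge_pos {P : ℝ × ℝ} (hP : P ≠ 0) : 0 < gauge K P :=
  (_root_.gauge_pos (absorbent_nhds_zero hK.mem_nhds)
    (NormedSpace.isVonNBounded_of_isBounded ℝ hK.isCompact.isBounded)).2 hP

theorem mem_iff_gauge_le_one {P : ℝ × ℝ} : P ∈ K ↔ gauge K P ≤ 1 := by
  rw [gauge_le_one_iff_mem_closure hK.convex hK.mem_nhds, hK.isCompact.isClosed.closure_eq]

theorem mem_frontier_iff {P : ℝ × ℝ} : P ∈ frontier K ↔ gauge K P = 1 :=
  (gauge_eq_one_iff_mem_frontier hK.convex hK.mem_nhds).symm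

theorem continuous_gauge : Continuous (gauge K) := _root_.continuous_gauge hK.convex hK.mem_nhds

theorem gauge_unitVec_pos (α : ℝ) : 0 < gauge K (unitVec α) := hK.gauge_pos (unitVec_ne_zero α)

theorem radius_pos (α : ℝ) : 0 < radius K α := inv_pos.2 (hK.gauge_unitVec_pos α)

theorem continuous_radius : Continuous (radius K) :=
  (hK.continuous_gauge.comp continuous_unitVec).inv₀ fun α => (hK.gauge_unitVec_pos α).ne'

theorem exists_le_radius : ∃ m : ℝ, 0 < m ∧ ∀ α, m ≤ radius K α := by
  obtain ⟨C, hC⟩ := hK.convex.lipschitz_gauge hK.mem_nhds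
  have hb : ∀ α, gauge K (unitVec α) ≤ C := by
    intro α
    have h := hC.dist_le_mul (unitVec α) 0
    rw [gauge_zero, Real.dist_eq, sub_zero, dist_zero_right] at h
    calc gauge K (unitVec α) ≤ |gauge K (unitVec α)| := le_abs_self _
      _ ≤ C * ‖unitVec α‖ := h
      _ ≤ C * 1 := by gcongr; exact norm_unitVec_le α
      _ = C := mul_one _
  have hC0 : (0 : ℝ) < C := (hK.gauge_unitVec_pos 0).trans_le (hb 0)
  exact ⟨(C : ℝ)⁻¹, inv_pos.2 hC0, fun α => inv_anti₀ (hK.gauge_unitVec_pos α) (hb α)⟩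

omit hK in
theorem radius_add_two_pi (α : ℝ) : radius K (α + 2 * Real.pi) = radius K α := by
  rw [radius, unitVec_add_two_pi, radius]

omit hK in
theorem gauge_smul_unitVec {r : ℝ} (hr : 0 ≤ r) (α : ℝ) :
    gauge K (r • unitVec α) = r / radius K α := by
  rw [gauge_smul_of_nonneg hr, radius, smul_eq_mul, div_inv_eq_mul]

theorem gauge_bdryPoint (α : ℝ) : gauge K (bdryPoint K α) = 1 := by
  rw [bdryPoint, gauge_smul_unitVec (hK.radius_pos α).le, div_self (hK.radius_pos α).ne']

theorem eq_bdryPoint {r α : ℝ} (hr : 0 ≤ r) (h : gauge K (r • unitVec α) = 1) :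
    r • unitVec α = bdryPoint K α := by
  rw [gauge_smul_unitVec hr, div_eq_one_iff_eq (hK.radius_pos α).ne'] at h
  rw [bdryPoint, h]

omit hK in
theorem bdryPoint_add_int_mul (α : ℝ) (k : ℤ) :
    bdryPoint K (α + k * (2 * Real.pi)) = bdryPoint K α := by
  rw [bdryPoint, radius, unitVec_add_int_mul, bdryPoint, radius]

theorem hasDerivAt_sweep (α : ℝ) : HasDerivAt (sweep K) (radius K α ^ 2) α :=
  ((hK.continuous_radius.pow 2).integral_hasStrictDerivAt 0 α).hasDerivAt

theorem contDiff_sweep : ContDiff ℝ 1 (sweep K) := by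
  rw [contDiff_one_iff_deriv]
  refine ⟨fun α => (hK.hasDerivAt_sweep α).differentiableAt, ?_⟩
  have : deriv (sweep K) = fun α => radius K α ^ 2 :=
    funext fun α => (hK.hasDerivAt_sweep α).deriv
  rw [this]
  exact hK.continuous_radius.pow 2

/-- The radius is bounded away from zero, so the swept area grows at least linearly; both strict
monotonicity and surjectivity of `sweep K` come from this one bound. -/
theorem exists_mul_sub_le_sweep :
    ∃ m : ℝ, 0 < m ∧ ∀ ⦃α β : ℝ⦄, α ≤ β → m * (β - α) ≤ sweep K β - sweep K α := by
  obtain ⟨m, hm, h⟩ := hK.exists_le_radius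
  refine ⟨m ^ 2, by positivity, mul_sub_le_image_sub_of_le_deriv
    (fun α => (hK.hasDerivAt_sweep α).differentiableAt) fun α => ?_⟩
  rw [(hK.hasDerivAt_sweep α).deriv]
  exact pow_le_pow_left₀ hm.le (h α) 2

theorem strictMono_sweep : StrictMono (sweep K) := by
  obtain ⟨m, hm, h⟩ := hK.exists_mul_sub_le_sweep
  intro α β hαβ
  nlinarith [h hαβ.le, mul_pos hm (sub_pos.2 hαβ)]

omit hK in
theorem sweep_zero : sweep K 0 = 0 := by simp [sweep]

theorem surjective_sweep : Function.Surjective (sweep K) := by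
  obtain ⟨m, hm, h⟩ := hK.exists_mul_sub_le_sweep
  have hc : Continuous (sweep K) := hK.contDiff_sweep.continuous
  refine hc.surjective ?_ ?_
  · refine Filter.tendsto_atTop_mono' _ (f₁ := fun α => m * α) ?_
      (Filter.tendsto_id.const_mul_atTop hm)
    filter_upwards [Filter.eventually_ge_atTop 0] with α hα
    have := h hα
    rw [sweep_zero] at this
    linarith
  · refine Filter.tendsto_atBot_mono' _ (f₁ := fun α => m * α) ?_
      (Filter.tendsto_id.const_mul_atBot hm)
    filter_upwards [Filter.eventually_le_atBot 0] with α hα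
    have := h hα
    rw [sweep_zero] at this
    linarith

theorem sweep_add_int_mul (α : ℝ) (k : ℤ) :
    sweep K (α + k * (2 * Real.pi)) = sweep K α + k * sweep K (2 * Real.pi) := by
  have hper : Function.Periodic (fun β => radius K β ^ 2) (2 * Real.pi) := fun β => by
    simp only [radius_add_two_pi]
  have hint : ∀ a b, IntervalIntegrable (fun β => radius K β ^ 2) volume a b := fun a b =>
    (hK.continuous_radius.pow 2).intervalIntegrable a b
  have h := hper.intervalIntegral_add_zsmul_eq k α hint
  rw [hper.intervalIntegral_add_eq α 0, zero_add, zsmul_eq_mul, zsmul_eq_mul] at h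
  rw [sweep, ← intervalIntegral.integral_add_adjacent_intervals (hint 0 α) (hint α _), h]
  rfl

end PlaneBody


/-! ### Areas of sectors and the generalized angle -/

theorem lintegral_ofReal_Ioc {r : ℝ} (hr : 0 ≤ r) :
    ∫⁻ s in Ioc 0 r, ENNReal.ofReal s = ENNReal.ofReal (r ^ 2 / 2) := by
  rw [← ofReal_integral_eq_lintegral_ofReal]
  · rw [← intervalIntegral.integral_of_le hr, integral_id]
    simp
  · exact (continuous_id.integrableOn_Icc (a := 0) (b := r)).mono_set Ioc_subset_Icc_self
  · filter_upwards [ae_restrict_mem measurableSet_Ioc] with s hs using hs.1.le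

/-- The closed cone of directions between `0` and `α`. -/
def angularCone (α : ℝ) : Set (ℝ × ℝ) :=
  {P | ∃ r : ℝ, 0 ≤ r ∧ ∃ β ∈ Icc (0 : ℝ) α, P = r • unitVec β}

theorem sector_eq (K : Set (ℝ × ℝ)) (α : ℝ) : sector K α = K ∩ angularCone α := rfl

theorem measurableSet_angularCone (α : ℝ) : MeasurableSet (angularCone α) := by
  have h : angularCone α =
      ⋃ m : ℕ, (fun p : ℝ × ℝ => p.1 • unitVec p.2) '' (Icc (0 : ℝ) m ×ˢ Icc (0 : ℝ) α) := by
    ext P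
    simp only [angularCone, mem_ofPred_eq, mem_iUnion, mem_image, mem_prod, Prod.exists]
    constructor
    · rintro ⟨r, hr, β, hβ, rfl⟩
      obtain ⟨m, hm⟩ := exists_nat_ge r
      exact ⟨m, r, β, ⟨⟨hr, hm⟩, hβ⟩, rfl⟩
    · rintro ⟨m, r, β, ⟨hr, hβ⟩, rfl⟩
      exact ⟨r, hr.1, β, hβ, rfl⟩
  rw [h]
  refine MeasurableSet.iUnion fun m => IsCompact.measurableSet ?_
  refine (isCompact_Icc.prod isCompact_Icc).image ?_
  exact continuous_fst.smul (continuous_unitVec.comp continuous_snd)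

theorem smul_mem_angularCone_iff {r α : ℝ} (hr : 0 < r) {P : ℝ × ℝ} :
    r • P ∈ angularCone α ↔ P ∈ angularCone α := by
  constructor
  · rintro ⟨s, hs, β, hβ, h⟩
    refine ⟨r⁻¹ * s, by positivity, β, hβ, ?_⟩
    rw [mul_smul, ← h, smul_smul, inv_mul_cancel₀ hr.ne', one_smul]
  · rintro ⟨s, hs, β, hβ, rfl⟩
    exact ⟨r * s, by positivity, β, hβ, by rw [mul_smul]⟩

theorem unitVec_mem_angularCone_iff {α β : ℝ} (hα : α < 2 * Real.pi)
    (hβ : β ∈ Ico 0 (2 * Real.pi)) :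
    unitVec β ∈ angularCone α ↔ β ≤ α := by
  constructor
  · rintro ⟨r, hr, β', hβ', h⟩
    have hr0 : 0 < r := by
      refine lt_of_le_of_ne hr fun h0 => unitVec_ne_zero β ?_
      rw [h, ← h0, zero_smul]
    rw [← one_smul ℝ (unitVec β)] at h
    obtain ⟨k, hk⟩ := eq_of_smul_unitVec_eq one_pos hr0 h
    have hpi := Real.two_pi_pos
    -- Both angles lie in [0, 2π), so they differ by less than a full turn.
    have hk0 : k = 0 := by
      have h1 : (k : ℝ) < 1 := by
        by_contra! hc
        nlinarith [hβ.2, hβ'.1]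
      have h2 : (-1 : ℝ) < k := by
        by_contra! hc
        nlinarith [hβ.1, hβ'.2]
      have h1' : k < 1 := by exact_mod_cast h1
      have h2' : -1 < k := by exact_mod_cast h2
      omega
    subst hk0
    rw [hk]; simpa using hβ'.2
  · intro h
    exact ⟨1, zero_le_one, β, ⟨hβ.1, h⟩, (one_smul _ _).symm⟩

namespace PlaneBody

variable {K : Set (ℝ × ℝ)} (hK : PlaneBody K)
include hK

/-- In polar coordinates membership in the cone depends on the direction alone and membership in K
reads r ≤ `radius K β`; integrating r dr gives half the squared radius. -/
theorem volume_inter_cone {C : Set (ℝ × ℝ)} (hC : MeasurableSet C)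
    (hcone : ∀ r : ℝ, 0 < r → ∀ P, r • P ∈ C ↔ P ∈ C) :
    volume (K ∩ C) = ∫⁻ β in Ioo (-Real.pi) Real.pi,
      ENNReal.ofReal ((unitVec ⁻¹' C).indicator (fun β => radius K β ^ 2 / 2) β) := by
  have hm : MeasurableSet (K ∩ C) := hK.isCompact.measurableSet.inter hC
  rw [← lintegral_indicator_one hm, ← lintegral_comp_polarCoord_symm, polarCoord_target,
    Measure.volume_eq_prod, ← Measure.prod_restrict, lintegral_prod_symm']
  · refine lintegral_congr fun β => ?_
    have hp : ∀ r ∈ Ioi (0 : ℝ), ENNReal.ofReal (r, β).1 •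
        (K ∩ C).indicator (1 : ℝ × ℝ → ENNReal) (polarCoord.symm (r, β)) =
        (Ioc 0 (radius K β)).indicator (fun s => ENNReal.ofReal s *
          (unitVec ⁻¹' C).indicator (1 : ℝ → ENNReal) β) r := by
      intro r hr
      have hr' : (0 : ℝ) < r := hr
      have hP : polarCoord.symm (r, β) = r • unitVec β := by
        rw [polarCoord_symm_apply]; rfl
      have hmem : r • unitVec β ∈ K ↔ r ≤ radius K β := by
        rw [hK.mem_iff_gauge_le_one, gauge_smul_unitVec hr'.le, div_le_one (hK.radius_pos β)]
      rw [hP]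
      by_cases h1 : r ≤ radius K β <;> by_cases h2 : unitVec β ∈ C <;>
        simp [indicator, hmem, hcone r hr', h1, h2, hr']
    rw [setLIntegral_congr_fun measurableSet_Ioi hp, lintegral_indicator measurableSet_Ioc,
      Measure.restrict_restrict measurableSet_Ioc,
      inter_eq_self_of_subset_left (Ioc_subset_Ioi_self),
      lintegral_mul_const _ ENNReal.measurable_ofReal,
      lintegral_ofReal_Ioc (hK.radius_pos β).le]
    by_cases h2 : unitVec β ∈ C <;> simp [indicator, h2]
  · refine Measurable.mul (ENNReal.measurable_ofReal.comp measurable_fst) ?_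
    exact (measurable_one.indicator hm).comp (by
      have := continuous_polarCoord_symm.measurable
      exact this)

/-- The range (−π, π) of polar coordinates is shifted by periodicity to [0, 2π], where `sector`
takes its directions. -/
theorem area_inter_cone {C : Set (ℝ × ℝ)} (hC : MeasurableSet C)
    (hcone : ∀ r : ℝ, 0 < r → ∀ P, r • P ∈ C ↔ P ∈ C) :
    area (K ∩ C) = ∫ β in (0 : ℝ)..(2 * Real.pi),
      (unitVec ⁻¹' C).indicator (fun β => radius K β ^ 2 / 2) β := by
  have hm : MeasurableSet (unitVec ⁻¹' C) := continuous_unitVec.measurable hC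
  have hper : Function.Periodic ((unitVec ⁻¹' C).indicator fun β => radius K β ^ 2 / 2)
      (2 * Real.pi) := by
    intro β
    have hmem : β + 2 * Real.pi ∈ unitVec ⁻¹' C ↔ β ∈ unitVec ⁻¹' C := by
      rw [mem_preimage, unitVec_add_two_pi, mem_preimage]
    by_cases h : β ∈ unitVec ⁻¹' C
    · rw [indicator_of_mem h, indicator_of_mem (hmem.2 h), radius_add_two_pi]
    · rw [indicator_of_notMem h, indicator_of_notMem fun h' => h (hmem.1 h')]
  have h := hper.intervalIntegral_add_eq 0 (-Real.pi)
  rw [zero_add] at h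
  rw [h, show -Real.pi + 2 * Real.pi = Real.pi by ring,
    intervalIntegral.integral_of_le (by linarith [Real.pi_pos]), integral_Ioc_eq_integral_Ioo,
    integral_eq_lintegral_of_nonneg_ae, area, hK.volume_inter_cone hC hcone]
  · exact Filter.Eventually.of_forall fun β => indicator_nonneg (fun _ _ => by positivity) β
  · exact (((hK.continuous_radius.pow 2).div_const 2).measurable.indicator hm).aestronglyMeasurable

theorem area_eq : area K = sweep K (2 * Real.pi) / 2 := by
  have h := hK.area_inter_cone MeasurableSet.univ (by simp)
  simp only [inter_univ, preimage_univ, indicator_univ] at h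
  rw [h, intervalIntegral.integral_div, sweep]

theorem area_sector {α : ℝ} (hα : α ∈ Ico 0 (2 * Real.pi)) :
    area (sector K α) = sweep K α / 2 := by
  have hc : Continuous fun β => radius K β ^ 2 / 2 := (hK.continuous_radius.pow 2).div_const 2
  have hm : MeasurableSet (unitVec ⁻¹' angularCone α) :=
    continuous_unitVec.measurable (measurableSet_angularCone α)
  rw [sector_eq, hK.area_inter_cone (measurableSet_angularCone α)
    fun r hr P => smul_mem_angularCone_iff hr]
  have hint : ∀ a b, IntervalIntegrable
      ((unitVec ⁻¹' angularCone α).indicator fun β => radius K β ^ 2 / 2) volume a b := by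
    intro a b
    have := hc.intervalIntegrable (μ := volume) a b
    exact ⟨this.1.indicator hm, this.2.indicator hm⟩
  rw [← intervalIntegral.integral_add_adjacent_intervals (hint 0 α) (hint α _),
    sweep, ← intervalIntegral.integral_div]
  have h1 : ∫ β in (0 : ℝ)..α, (unitVec ⁻¹' angularCone α).indicator
      (fun β => radius K β ^ 2 / 2) β = ∫ β in (0 : ℝ)..α, radius K β ^ 2 / 2 := by
    refine intervalIntegral.integral_congr fun β hβ => ?_
    rw [uIcc_of_le hα.1] at hβ
    refine indicator_of_mem ?_ _
    exact (unitVec_mem_angularCone_iff hα.2 ⟨hβ.1, hβ.2.trans_lt hα.2⟩).2 hβ.2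
  have h2 : ∫ β in α..(2 * Real.pi), (unitVec ⁻¹' angularCone α).indicator
      (fun β => radius K β ^ 2 / 2) β = 0 := by
    rw [intervalIntegral.integral_of_le hα.2.le, integral_Ioc_eq_integral_Ioo]
    refine setIntegral_eq_zero_of_forall_eq_zero fun β hβ => ?_
    refine indicator_of_notMem ?_ _
    intro hmem
    exact hβ.1.not_ge
      ((unitVec_mem_angularCone_iff hα.2 ⟨hα.1.trans hβ.1.le, hβ.2⟩).1 hmem)
  rw [h1, h2, add_zero]

/-- This is the bridge from the definition by areas to polar coordinates. Twice the area of K is one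
full turn of `sweep K`, so the integer in the definition counts turns, and injectivity of `sweep K`
turns equal areas into equal directions. -/
theorem isAnglePoint_sweep_iff (α : ℝ) (P : ℝ × ℝ) :
    IsAnglePoint K (sweep K α) P ↔ P = bdryPoint K α := by
  constructor
  · rintro ⟨hP, β, hβ, r, hr, hPr, k, hk⟩
    have hPr' : P = r • unitVec β := hPr
    rw [hK.mem_frontier_iff, hPr'] at hP
    rw [hPr', hK.eq_bdryPoint hr.le hP]
    rw [hK.area_sector hβ, hK.area_eq] at hk
    have h : sweep K β = sweep K (α + k * (2 * Real.pi)) := by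
      rw [hK.sweep_add_int_mul]; linarith
    rw [hK.strictMono_sweep.injective h, bdryPoint_add_int_mul]
  · rintro rfl
    refine ⟨hK.mem_frontier_iff.2 (hK.gauge_bdryPoint α), ?_⟩
    obtain ⟨k, hk, -⟩ := existsUnique_add_zsmul_mem_Ico Real.two_pi_pos α 0
    rw [zsmul_eq_mul, zero_add] at hk
    refine ⟨α + k * (2 * Real.pi), hk, radius K α, hK.radius_pos α, ?_, k, ?_⟩
    · change radius K α • unitVec α = radius K α • unitVec (α + k * (2 * Real.pi))
      rw [unitVec_add_int_mul]
    · rw [hK.area_sector hk, hK.sweep_add_int_mul, hK.area_eq]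
      ring

theorem anglePoint_sweep (α : ℝ) : anglePoint K (sweep K α) = bdryPoint K α := by
  rw [← hK.isAnglePoint_sweep_iff]
  exact Classical.epsilon_spec ⟨_, (hK.isAnglePoint_sweep_iff α _).2 rfl⟩

/-- The homeomorphism of the line taking a Euclidean polar angle to the generalized angle. -/
noncomputable def sweepIso : ℝ ≃o ℝ :=
  hK.strictMono_sweep.orderIsoOfSurjective _ hK.surjective_sweep

theorem sweep_sweepIso_symm (θ : ℝ) : sweep K (hK.sweepIso.symm θ) = θ :=
  hK.sweepIso.apply_symm_apply θ

theorem anglePoint_eq (θ : ℝ) : anglePoint K θ = bdryPoint K (hK.sweepIso.symm θ) := by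
  rw [← hK.anglePoint_sweep, hK.sweep_sweepIso_symm]

theorem gauge_anglePoint (θ : ℝ) : gauge K (anglePoint K θ) = 1 := by
  rw [hK.anglePoint_eq, hK.gauge_bdryPoint]

theorem anglePoint_mem (θ : ℝ) : anglePoint K θ ∈ K :=
  hK.mem_iff_gauge_le_one.2 (hK.gauge_anglePoint θ).le

theorem continuous_anglePoint : Continuous (anglePoint K) := by
  have h : anglePoint K = fun θ => bdryPoint K (hK.sweepIso.symm θ) := funext hK.anglePoint_eq
  rw [h]
  exact (hK.continuous_radius.smul continuous_unitVec).comp hK.sweepIso.symm.continuous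

theorem continuous_cosOf : Continuous (cosOf K) := continuous_fst.comp hK.continuous_anglePoint

theorem continuous_sinOf : Continuous (sinOf K) := continuous_snd.comp hK.continuous_anglePoint

/-- A measurable choice of the generalized angle of a boundary point. -/
theorem exists_measurable_angle :
    ∃ a : ℝ × ℝ → ℝ, Measurable a ∧ ∀ P, gauge K P = 1 → anglePoint K (a P) = P := by
  refine ⟨fun P => sweep K (Complex.arg ⟨P.1, P.2⟩), ?_, fun P hP => ?_⟩
  · refine hK.contDiff_sweep.continuous.measurable.comp (Complex.measurable_arg.comp ?_)
    exact Complex.measurableEquivRealProd.symm.measurable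
  · have hP0 : P ≠ 0 := by
      rintro rfl
      simp at hP
    obtain ⟨hr, h⟩ := exists_eq_smul_unitVec hP0
    rw [hK.anglePoint_sweep]
    rw [h] at hP
    exact (hK.eq_bdryPoint hr.le hP).symm.trans h.symm

theorem hasDerivAt_sweepIso_symm (θ : ℝ) :
    HasDerivAt hK.sweepIso.symm (radius K (hK.sweepIso.symm θ) ^ 2)⁻¹ θ :=
  HasDerivAt.of_local_left_inverse hK.sweepIso.symm.continuous.continuousAt
    (hK.hasDerivAt_sweep _) (pow_pos (hK.radius_pos _) 2).ne'
    (Filter.Eventually.of_forall hK.sweep_sweepIso_symm)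

theorem lipOn_sweepIso_symm {T : ℝ} {θ : ℝ → ℝ} (hθ : LipOn T θ) :
    LipOn T fun t => hK.sweepIso.symm (θ t) := by
  refine hθ.contDiff_comp (φ := hK.sweepIso.symm) fun t _ => ContDiff.contDiffAt ?_
  rw [contDiff_one_iff_deriv]
  refine ⟨fun θ => (hK.hasDerivAt_sweepIso_symm θ).differentiableAt, ?_⟩
  have h : deriv hK.sweepIso.symm = fun θ => (radius K (hK.sweepIso.symm θ) ^ 2)⁻¹ :=
    funext fun θ => (hK.hasDerivAt_sweepIso_symm θ).deriv
  rw [h]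
  exact ((hK.continuous_radius.comp hK.sweepIso.symm.continuous).pow 2).inv₀
    fun θ => (pow_pos (hK.radius_pos _) 2).ne'

theorem lipOn_gauge {T : ℝ} {Q : ℝ → ℝ × ℝ} (hQ : LipOn T Q) : LipOn T fun t => gauge K (Q t) := by
  obtain ⟨C, hC⟩ := hK.convex.lipschitz_gauge hK.mem_nhds
  exact hQ.lipschitz_comp hC

/-- The boundary may have corners, but gauges of convex bodies are Lipschitz, so the radius is a
Lipschitz function of the Euclidean angle, which in turn is a C¹ function of the generalized one. -/
theorem lipOn_anglePoint {T : ℝ} {θ : ℝ → ℝ} (hθ : LipOn T θ) :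
    LipOn T (fun t => cosOf K (θ t)) ∧ LipOn T (fun t => sinOf K (θ t)) := by
  have hα := hK.lipOn_sweepIso_symm hθ
  have hcos := hα.contDiff_comp (φ := Real.cos) fun t _ => Real.contDiff_cos.contDiffAt
  have hsin := hα.contDiff_comp (φ := Real.sin) fun t _ => Real.contDiff_sin.contDiffAt
  have hr : LipOn T fun t => radius K (hK.sweepIso.symm (θ t)) :=
    (hK.lipOn_gauge (hcos.prodMk hsin)).contDiff_comp (φ := fun r : ℝ => r⁻¹) fun t _ =>
      contDiffAt_inv ℝ (hK.gauge_unitVec_pos _).ne'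
  refine ⟨(hr.mul hcos).congr fun t _ => ?_, (hr.mul hsin).congr fun t _ => ?_⟩
  · rw [cosOf, hK.anglePoint_eq]; rfl
  · rw [sinOf, hK.anglePoint_eq]; rfl

/-- The derivative of the generalized angle along a curve on the boundary. -/
theorem cross_deriv_anglePoint {θ : ℝ → ℝ} {t k c s : ℝ} (hθ : HasDerivAt θ k t)
    (hc : HasDerivAt (fun t => cosOf K (θ t)) c t) (hs : HasDerivAt (fun t => sinOf K (θ t)) s t) :
    cosOf K (θ t) * s - sinOf K (θ t) * c = k := by
  set α : ℝ → ℝ := fun t => hK.sweepIso.symm (θ t) with hα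
  set ρ := radius K (α t) with hρ
  have hρ0 : 0 < ρ := hK.radius_pos _
  have hdα : HasDerivAt α ((ρ ^ 2)⁻¹ * k) t := (hK.hasDerivAt_sweepIso_symm (θ t)).comp t hθ
  have ecos : ∀ t, cosOf K (θ t) = radius K (α t) * Real.cos (α t) := fun t => by
    rw [cosOf, hK.anglePoint_eq]; rfl
  have esin : ∀ t, sinOf K (θ t) = radius K (α t) * Real.sin (α t) := fun t => by
    rw [sinOf, hK.anglePoint_eq]; rfl
  -- The boundary point is parallel to its own direction. Differentiating this identity yields the
  -- cross product without differentiating the radius.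
  have h0 : HasDerivAt (fun t => cosOf K (θ t) * Real.sin (α t) - sinOf K (θ t) * Real.cos (α t))
      0 t := by
    have : (fun t => cosOf K (θ t) * Real.sin (α t) - sinOf K (θ t) * Real.cos (α t)) =
        fun _ => 0 := by
      funext t; rw [ecos, esin]; ring
    rw [this]
    exact hasDerivAt_const t 0
  have h1 := ((hc.mul hdα.sin).sub (hs.mul hdα.cos)).unique h0
  rw [ecos, esin] at h1 ⊢
  have e := Real.cos_sq_add_sin_sq (α t)
  have hk : ρ ^ 2 * ((ρ ^ 2)⁻¹ * k) = k := by field_simp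
  rw [← hρ] at h1 ⊢
  linear_combination (-ρ) * h1 + hk + ρ ^ 2 * ((ρ ^ 2)⁻¹ * k) * e

end PlaneBody


/-! ### Curves on the boundary of a planar body -/

/-- Integrates M dθ along a Lipschitz θ. It supplies the Euclidean polar angle of a planar curve
and, later, the area integrals in z. -/
theorem LipOn.exists_primitive {T : ℝ} (hT : 0 ≤ T) {θ M : ℝ → ℝ} (hθ : LipOn T θ)
    (hM : LipOn T M) (c : ℝ) : ∃ β : ℝ → ℝ, LipOn T β ∧ β 0 = c ∧
      ∀ᵐ t ∂(volume.restrict (Icc 0 T)), HasDerivAt β (deriv θ t * M t) t := by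
  obtain ⟨C, hC⟩ := isCompact_Icc.exists_bound_of_continuousOn hM.continuousOn
  obtain ⟨L, hL⟩ := hθ
  -- Clamping the argument to [0, T] extends M continuously to the line, which gives measurability.
  set N : ℝ → ℝ := fun t => M (max 0 (min t T)) with hN
  have hclamp : ∀ t ∈ Icc 0 T, N t = M t := fun t ht => by
    rw [hN]; simp only; rw [min_eq_left ht.2, max_eq_right ht.1]
  have hNc : Continuous N := hM.continuousOn.comp_continuous (by fun_prop) fun t =>
    ⟨le_max_left _ _, max_le hT (min_le_right _ _)⟩
  -- The Lipschitz constant bounds the derivative only in the open interval, hence the indicator.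
  set l : ℝ → ℝ := (Ioo 0 T).indicator fun t => deriv θ t * N t with hl
  have hlm : Measurable l :=
    ((measurable_deriv θ).mul hNc.measurable).indicator measurableSet_Ioo
  have hC0 : 0 ≤ C := (norm_nonneg _).trans (hC 0 ⟨le_rfl, hT⟩)
  have hlb : ∀ t ∈ Icc 0 T, |l t| ≤ L * C := by
    intro t ht
    by_cases h : t ∈ Ioo 0 T
    · rw [hl, indicator_of_mem h, abs_mul, hclamp t ht]
      exact mul_le_mul (norm_deriv_le_of_lipschitzOn (Icc_mem_nhds h.1 h.2) hL) (hC t ht)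
        (abs_nonneg _) L.2
    · rw [hl, indicator_of_notMem h, abs_zero]
      exact mul_nonneg L.2 hC0
  refine ⟨fun t => c + ∫ τ in (0 : ℝ)..t, l τ, (LipOn.const c).add (LipOn.integral hT hlm hlb),
    by simp, ?_⟩
  filter_upwards [ae_hasDerivAt_integral hT hlm hlb, ae_mem_Ioo T] with t h1 h2
  rw [hl, indicator_of_mem h2, hclamp t (Ioo_subset_Icc_self h2)] at h1
  exact h1.const_add c

namespace PlaneBody

variable {K : Set (ℝ × ℝ)} (hK : PlaneBody K)
include hK

/-- A Lipschitz curve on the boundary of `K` is parametrized by any function whose derivative is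
the cross product of the curve and its velocity. -/
theorem anglePoint_eq_of_cross_deriv {T : ℝ} (hT : 0 ≤ T) {a b θ : ℝ → ℝ} (ha : LipOn T a)
    (hb : LipOn T b) (hθ : LipOn T θ) (h1 : ∀ t ∈ Icc 0 T, gauge K (a t, b t) = 1)
    (h0 : anglePoint K (θ 0) = (a 0, b 0))
    (hd : ∀ᵐ t ∂(volume.restrict (Icc 0 T)), ∃ a' b', HasDerivAt a a' t ∧ HasDerivAt b b' t ∧
      HasDerivAt θ (a t * b' - b t * a') t) :
    ∀ t ∈ Icc 0 T, anglePoint K (θ t) = (a t, b t) := by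
  set N : ℝ → ℝ := fun t => a t ^ 2 + b t ^ 2 with hN
  have hNL : LipOn T N := ((ha.mul ha).add (hb.mul hb)).congr fun t _ => by
    simp only [hN]; ring
  have hN0 : ∀ t ∈ Icc 0 T, 0 < N t := by
    intro t ht
    by_contra! hc
    have ea : a t = 0 := by
      have := sq_nonneg (a t); have := sq_nonneg (b t)
      exact pow_eq_zero_iff two_ne_zero |>.1 (by simp only [hN] at hc; linarith)
    have eb : b t = 0 := by
      have := sq_nonneg (a t); have := sq_nonneg (b t)
      exact pow_eq_zero_iff two_ne_zero |>.1 (by simp only [hN] at hc; linarith)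
    have := h1 t ht
    rw [ea, eb, ← Prod.zero_eq_mk, gauge_zero] at this
    exact zero_ne_one this
  have hinv : LipOn T fun t => (N t)⁻¹ := hNL.contDiff_comp (φ := fun x : ℝ => x⁻¹) fun t ht =>
    contDiffAt_inv ℝ (hN0 t ht).ne'
  have hsq : LipOn T fun t => (Real.sqrt (N t))⁻¹ :=
    hNL.contDiff_comp (φ := fun x : ℝ => (Real.sqrt x)⁻¹) fun t ht =>
      (Real.contDiffAt_sqrt (hN0 t ht).ne').inv (Real.sqrt_pos.2 (hN0 t ht)).ne'
  -- The Euclidean angle is built by integration, α' = θ'/|(a, b)|², which avoids lifting `arg`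
  -- along the curve.
  obtain ⟨α, hα, hα0, hαd⟩ := hθ.exists_primitive hT hinv (hK.sweepIso.symm (θ 0))
  have hcos : LipOn T fun t => Real.cos (α t) :=
    hα.contDiff_comp (φ := Real.cos) fun t _ => Real.contDiff_cos.contDiffAt
  have hsin : LipOn T fun t => Real.sin (α t) :=
    hα.contDiff_comp (φ := Real.sin) fun t _ => Real.contDiff_sin.contDiffAt
  -- This is the cosine of the angle between (a, b) and `unitVec (α t)`. Its derivative vanishes
  -- a.e., and it starts at 1.
  have hr : LipOn T fun t =>
      (a t * Real.cos (α t) + b t * Real.sin (α t)) * (Real.sqrt (N t))⁻¹ :=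
    ((ha.mul hcos).add (hb.mul hsin)).mul hsq
  have hconst := hr.eq_of_ae_hasDerivAt_zero hT (by
    filter_upwards [hd, hαd, ae_mem_Ioo T] with t ⟨a', b', da, db, dθ⟩ dα ht
    rw [dθ.deriv] at dα
    have hNt := hN0 t (Ioo_subset_Icc_self ht)
    have hst := Real.sqrt_pos.2 hNt
    have dN : HasDerivAt N (2 * a t * a' + 2 * b t * b') t := by
      have := (da.fun_pow 2).fun_add (db.fun_pow 2)
      simpa using this
    have dc := ((da.fun_mul dα.cos).fun_add (db.fun_mul dα.sin)).fun_mul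
      ((dN.sqrt hNt.ne').fun_inv hst.ne')
    refine dc.congr_deriv ?_
    have e2 : Real.sqrt (N t) ^ 2 = N t := Real.sq_sqrt hNt.le
    have e3 : N t = a t ^ 2 + b t ^ 2 := rfl
    field_simp
    rw [e2, e3]
    ring)
  have hα00 : (a 0, b 0) = bdryPoint K (α 0) := by rw [← h0, hK.anglePoint_eq, hα0]
  have key : ∀ t ∈ Icc 0 T, (a t, b t) = Real.sqrt (N t) • unitVec (α t) := by
    intro t ht
    have hNt := hN0 t ht
    have hst := Real.sqrt_pos.2 hNt
    have e2 : Real.sqrt (N t) ^ 2 = N t := Real.sq_sqrt hNt.le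
    have e3 : N t = a t ^ 2 + b t ^ 2 := rfl
    have e := Real.cos_sq_add_sin_sq (α t)
    have hr0 : (a 0 * Real.cos (α 0) + b 0 * Real.sin (α 0)) * (Real.sqrt (N 0))⁻¹ = 1 := by
      have ea : a 0 = radius K (α 0) * Real.cos (α 0) := congrArg Prod.fst hα00
      have eb : b 0 = radius K (α 0) * Real.sin (α 0) := congrArg Prod.snd hα00
      have e := Real.cos_sq_add_sin_sq (α 0)
      have eN : N 0 = radius K (α 0) ^ 2 := by
        change a 0 ^ 2 + b 0 ^ 2 = _
        rw [ea, eb]; linear_combination radius K (α 0) ^ 2 * e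
      rw [eN, Real.sqrt_sq (hK.radius_pos _).le, ea, eb, mul_inv_eq_one₀ (hK.radius_pos _).ne']
      linear_combination radius K (α 0) * e
    have hrt := (hconst t ht).trans hr0
    rw [mul_inv_eq_one₀ hst.ne'] at hrt
    -- Since the component of (a, b) along `unitVec (α t)` is its full length, the transverse
    -- component is zero.
    have hs : (-(a t) * Real.sin (α t) + b t * Real.cos (α t)) ^ 2 = 0 := by
      have : (a t * Real.cos (α t) + b t * Real.sin (α t)) ^ 2 +
          (-(a t) * Real.sin (α t) + b t * Real.cos (α t)) ^ 2 = N t := by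
        rw [e3]; linear_combination (a t ^ 2 + b t ^ 2) * e
      rw [hrt, e2] at this
      linarith
    have hs0 := pow_eq_zero_iff two_ne_zero |>.1 hs
    refine Prod.ext ?_ ?_
    · change a t = Real.sqrt (N t) * Real.cos (α t)
      rw [← hrt]; linear_combination -(a t) * e - Real.sin (α t) * hs0
    · change b t = Real.sqrt (N t) * Real.sin (α t)
      rw [← hrt]; linear_combination -(b t) * e + Real.cos (α t) * hs0
  have keyB : ∀ t ∈ Icc 0 T, (a t, b t) = bdryPoint K (α t) := by
    intro t ht
    rw [key t ht]
    refine hK.eq_bdryPoint (Real.sqrt_nonneg _) ?_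
    rw [← key t ht, h1 t ht]
  -- Now |(a, b)| is the radius in direction α, so the derivative radius² · α' of `sweep K (α t)`
  -- equals θ'.
  have hsweep : ∀ t ∈ Icc 0 T, sweep K (α t) = θ t := by
    refine LipOn.eq_of_ae_hasDerivAt (f' := deriv θ) hT
      (hα.contDiff_comp (φ := sweep K) fun t _ => hK.contDiff_sweep.contDiffAt) hθ
      (by simp only [hα0, hK.sweep_sweepIso_symm]) ?_
    filter_upwards [hd, hαd, ae_mem_Ioo T] with t ⟨a', b', da, db, dθ⟩ dα ht
    have htc := Ioo_subset_Icc_self ht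
    refine ⟨?_, dθ.differentiableAt.hasDerivAt⟩
    have h := (hK.hasDerivAt_sweep (α t)).comp t dα
    refine HasDerivAt.congr_deriv (f := fun t => sweep K (α t)) h ?_
    have hNr : N t = radius K (α t) ^ 2 := by
      have ea : a t = radius K (α t) * Real.cos (α t) := congrArg Prod.fst (keyB t htc)
      have eb : b t = radius K (α t) * Real.sin (α t) := congrArg Prod.snd (keyB t htc)
      have e := Real.cos_sq_add_sin_sq (α t)
      change a t ^ 2 + b t ^ 2 = _
      rw [ea, eb]; linear_combination radius K (α t) ^ 2 * e
    rw [← hNr]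
    have := (hN0 t htc).ne'
    field_simp
  intro t ht
  rw [← hsweep t ht, hK.anglePoint_sweep, keyB t ht]

/-! ### The polar body -/

theorem polar : PlaneBody (polarSet K) := by
  refine ⟨Metric.isCompact_of_isClosed_isBounded ?_ ?_, ?_, ?_⟩
  · have h : polarSet K = ⋂ P ∈ K, {Q : ℝ × ℝ | Q.1 * P.1 + Q.2 * P.2 ≤ 1} := by
      ext Q; simp [polarSet]
    rw [h]
    exact isClosed_biInter fun P _ => isClosed_le (by fun_prop) continuous_const
  · obtain ⟨r, hr, hball⟩ := Metric.mem_nhds_iff.1 hK.mem_nhds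
    have hmem : ∀ P : ℝ × ℝ, |P.1| < r → |P.2| < r → P ∈ K := fun P h1 h2 =>
      hball (by rw [mem_ball_zero_iff, Prod.norm_def]; exact max_lt h1 h2)
    refine isBounded_iff_forall_norm_le.2 ⟨2 / r, fun Q hQ => ?_⟩
    have hr2 : |r / 2| < r := by rw [abs_of_pos (by positivity)]; linarith
    have hr2' : |-(r / 2)| < r := by rwa [abs_neg]
    have hr0 : |(0 : ℝ)| < r := by simpa using hr
    have h1 := hQ (r / 2, 0) (hmem _ hr2 hr0)
    have h2 := hQ (-(r / 2), 0) (hmem _ hr2' hr0)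
    have h3 := hQ (0, r / 2) (hmem _ hr0 hr2)
    have h4 := hQ (0, -(r / 2)) (hmem _ hr0 hr2')
    simp only [mul_zero, add_zero, zero_add] at h1 h2 h3 h4
    rw [Prod.norm_def, Real.norm_eq_abs, Real.norm_eq_abs]
    refine max_le (abs_le.2 ⟨?_, ?_⟩) (abs_le.2 ⟨?_, ?_⟩)
    · rw [neg_le, le_div_iff₀ hr]; linarith
    · rw [le_div_iff₀ hr]; linarith
    · rw [neg_le, le_div_iff₀ hr]; linarith
    · rw [le_div_iff₀ hr]; linarith
  · intro Q hQ R hR s t hs ht hst P hP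
    have h1 := mul_le_mul_of_nonneg_left (hQ P hP) hs
    have h2 := mul_le_mul_of_nonneg_left (hR P hP) ht
    simp only [Prod.fst_add, Prod.snd_add, Prod.smul_fst, Prod.smul_snd, smul_eq_mul]
    linarith
  · obtain ⟨R, hR⟩ := isBounded_iff_forall_norm_le.1 hK.isCompact.isBounded
    have hR0 : 0 ≤ R := (norm_nonneg _).trans (hR 0 (interior_subset hK.zero_mem))
    refine mem_interior_iff_mem_nhds.2 (Filter.mem_of_superset
      (Metric.ball_mem_nhds 0 (show 0 < 1 / (2 * (R + 1)) by positivity)) fun Q hQ P hP => ?_)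
    rw [mem_ball_zero_iff, lt_div_iff₀ (by positivity)] at hQ
    have hP' := hR P hP
    have p1 : |P.1| ≤ R := (norm_fst_le P).trans hP'
    have p2 : |P.2| ≤ R := (norm_snd_le P).trans hP'
    have q1 : |Q.1| ≤ ‖Q‖ := norm_fst_le Q
    have q2 : |Q.2| ≤ ‖Q‖ := norm_snd_le Q
    have m1 : Q.1 * P.1 ≤ ‖Q‖ * R := (le_abs_self _).trans (by
      rw [abs_mul]; exact mul_le_mul q1 p1 (abs_nonneg _) (norm_nonneg _))
    have m2 : Q.2 * P.2 ≤ ‖Q‖ * R := (le_abs_self _).trans (by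
      rw [abs_mul]; exact mul_le_mul q2 p2 (abs_nonneg _) (norm_nonneg _))
    nlinarith [norm_nonneg Q]

theorem inv_gauge_smul_mem {P : ℝ × ℝ} (hP : P ≠ 0) : (gauge K P)⁻¹ • P ∈ K := by
  rw [hK.mem_iff_gauge_le_one, gauge_smul_of_nonneg (inv_nonneg.2 (gauge_nonneg _)), smul_eq_mul,
    inv_mul_cancel₀ (hK.gauge_pos hP).ne']

/-- The defining inequality of the polar set, applied to both vectors divided by their gauges. It
plays the role of the Cauchy–Schwarz inequality; equality in it is the planar part of the maximum
condition. -/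
theorem dot_le_gauge_mul_gauge (Q P : ℝ × ℝ) :
    Q.1 * P.1 + Q.2 * P.2 ≤ gauge (polarSet K) Q * gauge K P := by
  by_cases hP : P = 0
  · subst hP; simp
  by_cases hQ : Q = 0
  · subst hQ; simp
  have gP := hK.gauge_pos hP
  have gQ := hK.polar.gauge_pos hQ
  have h := hK.polar.inv_gauge_smul_mem hQ _ (hK.inv_gauge_smul_mem hP)
  simp only [Prod.smul_fst, Prod.smul_snd, smul_eq_mul] at h
  rw [show (gauge (polarSet K) Q)⁻¹ * Q.1 * ((gauge K P)⁻¹ * P.1) +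
    (gauge (polarSet K) Q)⁻¹ * Q.2 * ((gauge K P)⁻¹ * P.2) =
    (Q.1 * P.1 + Q.2 * P.2) / (gauge (polarSet K) Q * gauge K P) by field_simp,
    div_le_one (by positivity)] at h
  exact h

theorem dot_le_gauge_polar {P : ℝ × ℝ} (hP : P ∈ K) (Q : ℝ × ℝ) :
    Q.1 * P.1 + Q.2 * P.2 ≤ gauge (polarSet K) Q :=
  (hK.dot_le_gauge_mul_gauge Q P).trans
    (mul_le_of_le_one_right (gauge_nonneg _) (hK.mem_iff_gauge_le_one.1 hP))

theorem exists_dot_eq_gauge_polar (Q : ℝ × ℝ) :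
    ∃ P ∈ K, Q.1 * P.1 + Q.2 * P.2 = gauge (polarSet K) Q := by
  obtain ⟨P, hP, hmax⟩ := hK.isCompact.exists_isMaxOn ⟨0, interior_subset hK.zero_mem⟩
    (f := fun P : ℝ × ℝ => Q.1 * P.1 + Q.2 * P.2) (by fun_prop)
  refine ⟨P, hP, le_antisymm (hK.dot_le_gauge_polar hP Q) ?_⟩
  by_cases hQ : Q = 0
  · subst hQ; simp
  -- The maximum is compared with the value at a positive multiple of Q itself.
  have hpos : 0 < Q.1 * P.1 + Q.2 * P.2 := by
    have h := hmax (hK.inv_gauge_smul_mem hQ)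
    simp only [mem_ofPred_eq, Prod.smul_fst, Prod.smul_snd, smul_eq_mul] at h
    refine lt_of_lt_of_le ?_ h
    have hg := inv_pos.2 (hK.gauge_pos hQ)
    have hsq : 0 < Q.1 ^ 2 + Q.2 ^ 2 := by
      have := (exists_eq_smul_unitVec hQ).1
      exact Real.sqrt_pos.1 this
    nlinarith [mul_pos hg hsq]
  have hmem : (Q.1 * P.1 + Q.2 * P.2)⁻¹ • Q ∈ polarSet K := by
    intro R hR
    have h := hmax hR
    simp only [mem_ofPred_eq] at h
    simp only [Prod.smul_fst, Prod.smul_snd, smul_eq_mul]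
    rw [mul_assoc, mul_assoc, ← mul_add, inv_mul_le_iff₀ hpos, mul_one]
    exact h
  rw [hK.polar.mem_iff_gauge_le_one, gauge_smul_of_nonneg (inv_nonneg.2 hpos.le), smul_eq_mul,
    inv_mul_le_iff₀ hpos, mul_one] at hmem
  exact hmem

/-- The velocity of a curve on the boundary of the polar body is the rotated supporting point,
times the cross product of the curve and its velocity. -/
theorem deriv_eq_of_support {a b : ℝ → ℝ} {a' b' t : ℝ} {P : ℝ × ℝ}
    (h1 : ∀ᶠ s in 𝓝 t, gauge (polarSet K) (a s, b s) = 1) (hP : P ∈ K)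
    (hPt : a t * P.1 + b t * P.2 = 1) (ha : HasDerivAt a a' t) (hb : HasDerivAt b b' t) :
    a' = -((a t * b' - b t * a') * P.2) ∧ b' = (a t * b' - b t * a') * P.1 := by
  -- The pairing of the curve with the fixed P never exceeds 1 near t and equals 1 at t, so a' P.1 +
  -- b' P.2 = 0; together with the normalization this determines (a', b') up to the cross product.
  have hmax : IsLocalMax (fun s => a s * P.1 + b s * P.2) t := by
    filter_upwards [h1] with s hs
    rw [hPt, ← hs]
    exact hK.dot_le_gauge_polar hP (a s, b s)
  have h0 := hmax.hasDerivAt_eq_zero ((ha.mul_const P.1).fun_add (hb.mul_const P.2))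
  constructor
  · linear_combination -a' * hPt + a t * h0
  · linear_combination -b' * hPt + b t * h0

end PlaneBody


/-! ### The set `Ξ`, its support function, and maximization of linear functions over `U` -/

/-- The gauges of the planar components of a horizontal vector. -/
noncomputable def gauges {n : ℕ} (Ω : Fin n → Set (ℝ × ℝ)) (w : HVec n) : Fin n → ℝ :=
  fun i => gauge (Ω i) (w.1 i, w.2 i)

/-- The gauges, in the polar planar sets, of the planar components of a horizontal covector. -/
noncomputable def polarGauges {n : ℕ} (Ω : Fin n → Set (ℝ × ℝ)) (h g : Fin n → ℝ) : Fin n → ℝ :=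
  fun i => gauge (polarSet (Ω i)) (h i, g i)

namespace SphericalForm

variable {n : ℕ} {U : Set (HVec n)} {Ω : Fin n → Set (ℝ × ℝ)} {μ : (Fin n → ℝ) → ℝ}
  (hU : SphericalForm U Ω μ)
include hU

theorem body (i : Fin n) : PlaneBody (Ω i) := ⟨hU.isCompact i, hU.convex i, hU.zero_mem i⟩

theorem map_zero : μ 0 = 0 := by
  have h := hU.homogeneous 2 two_pos 0 fun i => le_rfl
  rw [smul_zero] at h
  linarith

omit hU in
theorem isClosed_orthant : IsClosed {l : Fin n → ℝ | ∀ i, 0 ≤ l i} := by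
  simp only [ofPred_forall]
  exact isClosed_iInter fun i => isClosed_le continuous_const (continuous_apply i)

theorem isClosed_xiSet : IsClosed (xiSet μ) :=
  hU.continuousOn.preimage_isClosed_of_isClosed isClosed_orthant isClosed_Iic

theorem exists_norm_le : ∃ M, ∀ l ∈ xiSet μ, ‖l‖ ≤ M := by
  have hS : IsCompact ({l : Fin n → ℝ | ∀ i, 0 ≤ l i} ∩ Metric.sphere 0 1) :=
    (isCompact_sphere 0 1).inter_left isClosed_orthant
  rcases ({l : Fin n → ℝ | ∀ i, 0 ≤ l i} ∩ Metric.sphere 0 1).eq_empty_or_nonempty with he | hne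
  -- The unit sphere misses the orthant only for n = 0. Otherwise μ has a positive minimum there,
  -- and homogeneity bounds Ξ.
  · refine ⟨0, fun l hl => ?_⟩
    by_contra! hc
    refine (eq_empty_iff_forall_notMem.1 he) (‖l‖⁻¹ • l) ⟨fun i => ?_, ?_⟩
    · exact mul_nonneg (inv_nonneg.2 hc.le) (hl.1 i)
    · rw [mem_sphere_zero_iff_norm, norm_smul, norm_inv, norm_norm, inv_mul_cancel₀ hc.ne']
  · obtain ⟨m, hm, hmin⟩ := hS.exists_isMinOn hne (hU.continuousOn.mono inter_subset_left)
    have hm0 : m ≠ 0 := by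
      rintro rfl
      simpa using hm.2
    have hpos := hU.pos m hm.1 hm0
    refine ⟨1 / μ m, fun l hl => ?_⟩
    by_cases hl0 : l = 0
    · rw [hl0, norm_zero]; positivity
    have hn : 0 < ‖l‖ := norm_pos_iff.2 hl0
    have hmem : ‖l‖⁻¹ • l ∈ {l : Fin n → ℝ | ∀ i, 0 ≤ l i} ∩ Metric.sphere 0 1 :=
      ⟨fun i => mul_nonneg (inv_nonneg.2 hn.le) (hl.1 i), by
        rw [mem_sphere_zero_iff_norm, norm_smul, norm_inv, norm_norm, inv_mul_cancel₀ hn.ne']⟩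
    have h := hmin hmem
    simp only [mem_ofPred_eq] at h
    rw [hU.homogeneous _ (inv_pos.2 hn) l hl.1, ← div_eq_inv_mul, le_div_iff₀ hn] at h
    rw [le_div_iff₀ hpos]
    linarith [hl.2]

theorem isCompact_xiSet : IsCompact (xiSet μ) :=
  Metric.isCompact_of_isClosed_isBounded hU.isClosed_xiSet
    (isBounded_iff_forall_norm_le.2 hU.exists_norm_le)

theorem convex_xiSet : Convex ℝ (xiSet μ) := hU.convexOn.convex_le 1

theorem zero_mem_xiSet : (0 : Fin n → ℝ) ∈ xiSet μ :=
  ⟨fun _ => le_rfl, by rw [hU.map_zero]; exact zero_le_one⟩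

theorem sum_le_supportFun {l : Fin n → ℝ} (hl : l ∈ xiSet μ) (A : Fin n → ℝ) :
    ∑ i, A i * l i ≤ supportFun (xiSet μ) A :=
  le_csSup (hU.isCompact_xiSet.bddAbove_image (by fun_prop)) (mem_image_of_mem _ hl)

theorem exists_sum_eq_supportFun (A : Fin n → ℝ) :
    ∃ l ∈ xiSet μ, ∑ i, A i * l i = supportFun (xiSet μ) A := by
  obtain ⟨l, hl, h⟩ := hU.isCompact_xiSet.exists_sSup_image_eq ⟨0, hU.zero_mem_xiSet⟩
    (f := fun l : Fin n → ℝ => ∑ i, A i * l i) (by fun_prop)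
  exact ⟨l, hl, h.symm⟩

/-- A closed convex set is recovered from its support function: a point outside Ξ would be strictly
separated by a linear functional, whose coordinates serve as B. -/
theorem mem_xiSet_of_sum_le {l : Fin n → ℝ}
    (h : ∀ B : Fin n → ℝ, ∑ i, l i * B i ≤ supportFun (xiSet μ) B) : l ∈ xiSet μ := by
  by_contra hl
  obtain ⟨f, u, hf, hu⟩ := geometric_hahn_banach_closed_point hU.convex_xiSet hU.isClosed_xiSet hl
  have hsum : ∀ v : Fin n → ℝ, f v = ∑ i, v i * f fun j => if i = j then 1 else 0 := fun v => by
    simpa using LinearMap.pi_apply_eq_sum_univ f.toLinearMap v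
  obtain ⟨m, hm, hms⟩ := hU.exists_sum_eq_supportFun fun i => f (fun j => if i = j then 1 else 0)
  have h1 := hf m hm
  have h2 := h fun i => f (fun j => if i = j then 1 else 0)
  rw [hsum] at h1 hu
  rw [← hms] at h2
  have h3 : ∑ i, m i * f (fun j => if i = j then 1 else 0) = ∑ i, f (fun j => if i = j then 1 else 0) * m i :=
    Finset.sum_congr rfl fun i _ => mul_comm _ _
  linarith

/-- Positive homogeneity of the support function: testing the subgradient inequality at 0 and at 2A
forces Σ l_i A_i = s_Ξ(A). What remains says that l is dominated by s_Ξ, so l ∈ Ξ by separation.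
Thus ∂s_Ξ(A) is the face of Ξ exposed by A. -/
theorem mem_subdiff_iff {l A : Fin n → ℝ} :
    l ∈ subdiff (supportFun (xiSet μ)) A ↔
      l ∈ xiSet μ ∧ ∑ i, A i * l i = supportFun (xiSet μ) A := by
  have hlA : ∑ i, A i * l i = ∑ i, l i * A i := Finset.sum_congr rfl fun i _ => mul_comm _ _
  constructor
  · intro h
    have hscale : ∀ c : ℝ, 0 ≤ c → supportFun (xiSet μ) (c • A) ≤ c * supportFun (xiSet μ) A := by
      intro c hc
      obtain ⟨m, hm, hms⟩ := hU.exists_sum_eq_supportFun (c • A)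
      rw [← hms]
      calc ∑ i, (c • A) i * m i = c * ∑ i, A i * m i := by
            rw [Finset.mul_sum]
            exact Finset.sum_congr rfl fun i _ => by rw [Pi.smul_apply, smul_eq_mul, mul_assoc]
        _ ≤ _ := mul_le_mul_of_nonneg_left (hU.sum_le_supportFun hm A) hc
    have h0 := (h ((0 : ℝ) • A)).trans (hscale 0 le_rfl)
    have h2 := (h ((2 : ℝ) • A)).trans (hscale 2 zero_le_two)
    have e0 : ∑ i, l i * (((0 : ℝ) • A) i - A i) = -∑ i, l i * A i := by
      rw [← Finset.sum_neg_distrib]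
      exact Finset.sum_congr rfl fun i _ => by rw [Pi.smul_apply, smul_eq_mul]; ring
    have e2 : ∑ i, l i * (((2 : ℝ) • A) i - A i) = ∑ i, l i * A i :=
      Finset.sum_congr rfl fun i _ => by rw [Pi.smul_apply, smul_eq_mul]; ring
    rw [e0] at h0
    rw [e2] at h2
    have heq : ∑ i, l i * A i = supportFun (xiSet μ) A := by linarith
    refine ⟨hU.mem_xiSet_of_sum_le fun B => ?_, hlA.trans heq⟩
    have hB := h B
    simp only [mul_sub, Finset.sum_sub_distrib] at hB
    linarith
  · rintro ⟨hl, hs⟩ B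
    have hB := hU.sum_le_supportFun hl B
    have hlB : ∑ i, B i * l i = ∑ i, l i * B i := Finset.sum_congr rfl fun i _ => mul_comm _ _
    simp only [mul_sub, Finset.sum_sub_distrib]
    linarith

theorem measurableSet_subdiff (A : Fin n → ℝ) :
    MeasurableSet (subdiff (supportFun (xiSet μ)) A) := by
  have h : subdiff (supportFun (xiSet μ)) A =
      xiSet μ ∩ {l | ∑ i, A i * l i = supportFun (xiSet μ) A} := by
    ext l; exact hU.mem_subdiff_iff
  rw [h]
  exact (hU.isClosed_xiSet.inter (isClosed_eq (by fun_prop) continuous_const)).measurableSet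

theorem exists_abs_le_of_mem_subdiff (A : Fin n → ℝ) :
    ∃ M, ∀ l ∈ subdiff (supportFun (xiSet μ)) A, ∀ i, |l i| ≤ M := by
  obtain ⟨M, hM⟩ := hU.exists_norm_le
  exact ⟨M, fun l hl i => (norm_le_pi_norm l i).trans (hM l (hU.mem_subdiff_iff.1 hl).1)⟩

theorem mem_iff {w : HVec n} : w ∈ U ↔ gauges Ω w ∈ xiSet μ := by
  rw [hU.eq_setOf]
  exact ⟨fun h => ⟨fun _ => gauge_nonneg _, h⟩, fun h => h.2⟩

theorem mem_of_gauges_le {w : HVec n} {l : Fin n → ℝ} (hl : l ∈ xiSet μ)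
    (h : ∀ i, gauges Ω w i ≤ l i) : w ∈ U :=
  hU.mem_iff.2 ⟨fun _ => gauge_nonneg _,
    (hU.monotoneOn (fun _ => gauge_nonneg _) hl.1 h).trans hl.2⟩

theorem continuous_gauges : Continuous (gauges Ω) :=
  continuous_pi fun i => (hU.body i).continuous_gauge.comp (by fun_prop)

theorem measurableSet : MeasurableSet U := by
  have h : U = gauges Ω ⁻¹' xiSet μ := by ext w; exact hU.mem_iff
  rw [h]
  exact hU.continuous_gauges.measurable hU.isClosed_xiSet.measurableSet

theorem zero_mem_set : (0 : HVec n) ∈ U := by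
  refine hU.mem_of_gauges_le hU.zero_mem_xiSet fun i => ?_
  change gauge (Ω i) 0 ≤ 0
  rw [gauge_zero]

theorem sum_le {w : HVec n} (hw : w ∈ U) (h g : Fin n → ℝ) :
    ∑ i, (h i * w.1 i + g i * w.2 i) ≤ supportFun (xiSet μ) (polarGauges Ω h g) :=
  (Finset.sum_le_sum fun i _ => (hU.body i).dot_le_gauge_mul_gauge (h i, g i) (w.1 i, w.2 i)).trans
    (hU.sum_le_supportFun (hU.mem_iff.1 hw) _)

/-- Scale planar support points by a maximizing l ∈ Ξ. A support point of a zero covector may be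
interior to Ω_i, so the gauges are only at most l, and monotonicity of μ is what keeps the vector in
U. -/
theorem exists_sum_eq (h g : Fin n → ℝ) : ∃ w ∈ U,
    ∑ i, (h i * w.1 i + g i * w.2 i) = supportFun (xiSet μ) (polarGauges Ω h g) := by
  choose P hP hPs using fun i => (hU.body i).exists_dot_eq_gauge_polar (h i, g i)
  obtain ⟨l, hl, hls⟩ := hU.exists_sum_eq_supportFun (polarGauges Ω h g)
  refine ⟨(fun i => l i * (P i).1, fun i => l i * (P i).2), ?_, ?_⟩
  · refine hU.mem_of_gauges_le hl fun i => ?_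
    change gauge (Ω i) (l i • P i) ≤ l i
    rw [gauge_smul_of_nonneg (hl.1 i), smul_eq_mul]
    exact mul_le_of_le_one_right (hl.1 i) ((hU.body i).mem_iff_gauge_le_one.1 (hP i))
  · rw [← hls]
    refine Finset.sum_congr rfl fun i _ => ?_
    have := hPs i
    simp only at this
    rw [polarGauges, ← this]
    ring

/-- A velocity maximizes a linear function over `U` exactly when its planar components do so over
dilated planar sets, and its gauges maximize over `Ξ`. -/
theorem isMax_iff {w : HVec n} (hw : w ∈ U) (h g : Fin n → ℝ) :
    (∀ w' ∈ U, ∑ i, (h i * w'.1 i + g i * w'.2 i) ≤ ∑ i, (h i * w.1 i + g i * w.2 i)) ↔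
      gauges Ω w ∈ subdiff (supportFun (xiSet μ)) (polarGauges Ω h g) ∧
        ∀ i, h i * w.1 i + g i * w.2 i = polarGauges Ω h g i * gauges Ω w i := by
  have hle : ∀ i ∈ Finset.univ, h i * w.1 i + g i * w.2 i ≤ polarGauges Ω h g i * gauges Ω w i :=
    fun i _ => (hU.body i).dot_le_gauge_mul_gauge (h i, g i) (w.1 i, w.2 i)
  have hle2 := hU.sum_le_supportFun (hU.mem_iff.1 hw) (polarGauges Ω h g)
  rw [hU.mem_subdiff_iff]
  constructor
  · intro hmax
    -- A vector attaining the upper bound makes both inequalities equalities; an equality of sums of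
    -- termwise ordered numbers is termwise.
    obtain ⟨w', hw', hs⟩ := hU.exists_sum_eq h g
    have h1 := hmax w' hw'
    rw [hs] at h1
    have h2 := Finset.sum_le_sum hle
    refine ⟨⟨hU.mem_iff.1 hw, le_antisymm hle2 (h1.trans h2)⟩, fun i => ?_⟩
    exact (Finset.sum_eq_sum_iff_of_le hle).1 (le_antisymm h2 (hle2.trans h1)) i (Finset.mem_univ i)
  · rintro ⟨⟨-, hs⟩, heq⟩ w' hw'
    rw [Finset.sum_congr rfl fun i _ => heq i, hs]
    exact hU.sum_le hw' h g

end SphericalForm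


/-! ### Extremals in normalized coordinates -/

variable {n : ℕ}

/-- The derivative of the horizontal part of a curve. -/
noncomputable def velocity (x y : ℝ → Fin n → ℝ) (t : ℝ) : HVec n :=
  (fun i => deriv (fun s => x s i) t, fun i => deriv (fun s => y s i) t)

/-- The control agrees a.e. with the derivative of the curve. Derivatives are always measurable, so
the velocity can replace the control. -/
theorem measurable_velocity (x y : ℝ → Fin n → ℝ) : Measurable (velocity x y) :=
  (measurable_pi_lambda _ fun _ => measurable_deriv _).prodMk
    (measurable_pi_lambda _ fun _ => measurable_deriv _)

/-- The Pontryagin maximum principle in terms of the horizontal Hamiltonians `h`, `g`, with the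
vertical part of the covector normalized to `0`, `1` or `-1`. -/
structure NormalizedExtremal (U : Set (HVec n)) (T : ℝ) (x y : ℝ → Fin n → ℝ) (z : ℝ → ℝ)
    (γ : ℝ) (h g : ℝ → Fin n → ℝ) : Prop where
  vertical : γ = 0 ∨ γ = 1 ∨ γ = -1
  x_zero : ∀ i, x 0 i = 0
  y_zero : ∀ i, y 0 i = 0
  z_zero : z 0 = 0
  lipOn_x : ∀ i, LipOn T fun t => x t i
  lipOn_y : ∀ i, LipOn T fun t => y t i
  lipOn_z : LipOn T z
  lipOn_h : ∀ i, LipOn T fun t => h t i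
  lipOn_g : ∀ i, LipOn T fun t => g t i
  nontrivial : γ = 0 → ∀ t ∈ Icc 0 T, ¬(h t = 0 ∧ g t = 0)
  ae_max : ∀ᵐ t ∂(volume.restrict (Icc 0 T)), velocity x y t ∈ U ∧
    (∀ i, HasDerivAt (fun s => x s i) ((velocity x y t).1 i) t ∧
      HasDerivAt (fun s => y s i) ((velocity x y t).2 i) t ∧
      HasDerivAt (fun s => h s i) (-(γ * (velocity x y t).2 i)) t ∧
      HasDerivAt (fun s => g s i) (γ * (velocity x y t).1 i) t) ∧
    HasDerivAt z (1 / 2 * ∑ i, (x t i * (velocity x y t).2 i - y t i * (velocity x y t).1 i)) t ∧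
    ∀ w' ∈ U, ∑ i, (h t i * w'.1 i + g t i * w'.2 i) ≤
      ∑ i, (h t i * (velocity x y t).1 i + g t i * (velocity x y t).2 i)

theorem LipOn.heis {T : ℝ} {q : ℝ → Heis n} (hq : LipOn T q) :
    (∀ i, LipOn T fun t => (q t).1 i) ∧ (∀ i, LipOn T fun t => (q t).2.1 i) ∧
      LipOn T fun t => (q t).2.2 := by
  have h1 : LipOn T fun t => (q t).1 := hq.lipschitz_comp LipschitzWith.prod_fst
  have h2 : LipOn T fun t => (q t).2 := hq.lipschitz_comp LipschitzWith.prod_snd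
  have h21 : LipOn T fun t => (q t).2.1 := h2.lipschitz_comp LipschitzWith.prod_fst
  exact ⟨fun i => h1.lipschitz_comp (LipschitzWith.eval i),
    fun i => h21.lipschitz_comp (LipschitzWith.eval i), h2.lipschitz_comp LipschitzWith.prod_snd⟩

theorem hasDerivAt_heis_iff {q : ℝ → Heis n} {v : Heis n} {t : ℝ} :
    HasDerivAt q v t ↔ (∀ i, HasDerivAt (fun s => (q s).1 i) (v.1 i) t) ∧
      (∀ i, HasDerivAt (fun s => (q s).2.1 i) (v.2.1 i) t) ∧
      HasDerivAt (fun s => (q s).2.2) v.2.2 t := by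
  constructor
  · intro hq
    have h1 : HasDerivAt (fun s => (q s).1) v.1 t :=
      hq.hasFDerivAt.fst.hasDerivAt.congr_deriv (by simp)
    have h2 : HasDerivAt (fun s => (q s).2) v.2 t :=
      hq.hasFDerivAt.snd.hasDerivAt.congr_deriv (by simp)
    have h21 : HasDerivAt (fun s => (q s).2.1) v.2.1 t :=
      h2.hasFDerivAt.fst.hasDerivAt.congr_deriv (by simp)
    have h22 : HasDerivAt (fun s => (q s).2.2) v.2.2 t :=
      h2.hasFDerivAt.snd.hasDerivAt.congr_deriv (by simp)
    exact ⟨hasDerivAt_pi.1 h1, hasDerivAt_pi.1 h21, h22⟩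
  · rintro ⟨h1, h2, h3⟩
    exact (hasDerivAt_pi.2 h1).prodMk ((hasDerivAt_pi.2 h2).prodMk h3)

theorem pontryagin_eq (q p : Heis n) (w : HVec n) :
    pontryagin q p w = ∑ i, ((p.1 i - p.2.2 / 2 * q.2.1 i) * w.1 i +
      (p.2.1 i + p.2.2 / 2 * q.1 i) * w.2 i) := by
  simp only [pontryagin, pairing, leftVelocity]
  rw [Finset.mul_sum, Finset.mul_sum, ← Finset.sum_add_distrib, ← Finset.sum_add_distrib]
  exact Finset.sum_congr rfl fun i _ => by ring

theorem IsExtremal.exists_normalized {U : Set (HVec n)} {T : ℝ} (hT : 0 < T)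
    {x y : ℝ → Fin n → ℝ} {z : ℝ → ℝ} (hE : IsExtremal U T fun t => (x t, y t, z t)) :
    ∃ γ h g, NormalizedExtremal U T x y z γ h g := by
  obtain ⟨h0, w, p, -, hwU, hq, hp, hp0, hae⟩ := hE
  obtain ⟨hx, hy, hz⟩ := LipOn.heis hq
  obtain ⟨hφ, hψ, hζ⟩ := LipOn.heis hp
  simp only at hx hy hz
  have hζc : ∀ t ∈ Icc 0 T, (p t).2.2 = (p 0).2.2 := by
    refine hζ.eq_of_ae_hasDerivAt_zero hT.le ?_
    filter_upwards [hae] with t ht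
    exact (hasDerivAt_heis_iff.1 ht.2.1).2.2
  set ζ := (p 0).2.2 with hζdef
  -- c is 1/|ζ|, or 1 if ζ = 0. It must be positive to preserve the maximum condition.
  obtain ⟨c, hc, hcζ⟩ : ∃ c : ℝ, 0 < c ∧ (c * ζ = 0 ∨ c * ζ = 1 ∨ c * ζ = -1) := by
    rcases lt_trichotomy ζ 0 with hneg | hzero | hpos
    · refine ⟨(-ζ)⁻¹, by rw [inv_pos]; linarith, Or.inr (Or.inr ?_)⟩
      rw [inv_neg, neg_mul, inv_mul_cancel₀ hneg.ne]
    · exact ⟨1, one_pos, Or.inl (by rw [hzero, mul_zero])⟩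
    · exact ⟨ζ⁻¹, inv_pos.2 hpos, Or.inr (Or.inl (inv_mul_cancel₀ hpos.ne'))⟩
  refine ⟨c * ζ, fun t i => c * ((p t).1 i - ζ / 2 * y t i),
    fun t i => c * ((p t).2.1 i + ζ / 2 * x t i), hcζ, ?_, ?_, ?_, hx, hy, hz, ?_, ?_, ?_, ?_⟩
  · intro i; exact congrFun (congrArg Prod.fst h0) i
  · intro i; exact congrFun (congrArg (fun q : Heis n => q.2.1) h0) i
  · exact congrArg (fun q : Heis n => q.2.2) h0
  · exact fun i => ((hφ i).sub ((hy i).const_mul _)).const_mul c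
  · exact fun i => ((hψ i).add ((hx i).const_mul _)).const_mul c
  · rintro hγ t ht ⟨h1, h2⟩
    have hζ0 : ζ = 0 := (mul_eq_zero.1 hγ).resolve_left hc.ne'
    refine hp0 t ht (Prod.ext (funext fun i => ?_) (Prod.ext (funext fun i => ?_) ?_))
    · have := congrFun h1 i
      simp only [hζ0, zero_div, zero_mul, sub_zero, Pi.zero_apply, mul_eq_zero, hc.ne',
        false_or] at this
      exact this
    · have := congrFun h2 i
      simp only [hζ0, zero_div, zero_mul, add_zero, Pi.zero_apply, mul_eq_zero, hc.ne',
        false_or] at this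
      exact this
    · exact (hζc t ht).trans hζ0
  · filter_upwards [hae, ae_mem_Ioo T] with t ⟨dq, dp, hmax⟩ ht
    have htc := Ioo_subset_Icc_self ht
    obtain ⟨dx, dy, dz⟩ := hasDerivAt_heis_iff.1 dq
    obtain ⟨dφ, dψ, -⟩ := hasDerivAt_heis_iff.1 dp
    simp only [leftVelocity, adjointVelocity, hζc t htc] at dx dy dz dφ dψ
    have hv : velocity x y t = w t :=
      Prod.ext (funext fun i => (dx i).deriv) (funext fun i => (dy i).deriv)
    rw [hv]
    refine ⟨hwU t htc, fun i => ⟨dx i, dy i, ?_, ?_⟩, dz, fun w' hw' => ?_⟩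
    · refine (((dφ i).fun_sub ((dy i).const_mul (ζ / 2))).const_mul c).congr_deriv ?_
      ring
    · refine (((dψ i).fun_add ((dx i).const_mul (ζ / 2))).const_mul c).congr_deriv ?_
      ring
    · have h := mul_le_mul_of_nonneg_left (hmax w' hw') hc.le
      rw [pontryagin_eq, pontryagin_eq, Finset.mul_sum, Finset.mul_sum] at h
      simp only [hζc t htc] at h
      refine (le_of_eq ?_).trans (h.trans (le_of_eq ?_)) <;>
        exact Finset.sum_congr rfl fun i _ => by ring

theorem NormalizedExtremal.isExtremal {U : Set (HVec n)} (hUm : MeasurableSet U)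
    (hU0 : (0 : HVec n) ∈ U) {T : ℝ} {x y : ℝ → Fin n → ℝ} {z : ℝ → ℝ} {γ : ℝ}
    {h g : ℝ → Fin n → ℝ} (hE : NormalizedExtremal U T x y z γ h g) :
    IsExtremal U T fun t => (x t, y t, z t) := by
  classical
  refine ⟨Prod.ext (funext hE.x_zero) (Prod.ext (funext hE.y_zero) hE.z_zero),
    -- The control must lie in U at every instant, so it is set to 0 wherever the velocity fails to
    -- do so; in [0, T] those instants form a null set.
    fun t => if velocity x y t ∈ U then velocity x y t else 0,
    fun t => (fun i => h t i + γ / 2 * y t i, fun i => g t i - γ / 2 * x t i, γ),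
    ?_, ?_, ?_, ?_, ?_, ?_⟩
  · exact Measurable.ite (measurable_velocity x y hUm) (measurable_velocity x y) measurable_const
  · intro t _
    by_cases hv : velocity x y t ∈ U
    · simp only [hv, if_true]
    · simp only [hv, if_false, hU0]
  · exact (LipOn.pi hE.lipOn_x).prodMk ((LipOn.pi hE.lipOn_y).prodMk hE.lipOn_z)
  · exact (LipOn.pi fun i => (hE.lipOn_h i).add ((hE.lipOn_y i).const_mul _)).prodMk
      ((LipOn.pi fun i => (hE.lipOn_g i).sub ((hE.lipOn_x i).const_mul _)).prodMk
        (LipOn.const γ))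
  · intro t ht h0
    have hγ : γ = 0 := congrArg (fun q : Heis n => q.2.2) h0
    refine hE.nontrivial hγ t ht ⟨funext fun i => ?_, funext fun i => ?_⟩
    · have := congrFun (congrArg Prod.fst h0) i
      simpa [hγ] using this
    · have := congrFun (congrArg (fun q : Heis n => q.2.1) h0) i
      simpa [hγ] using this
  · filter_upwards [hE.ae_max] with t ⟨hv, hd, dz, hmax⟩
    simp only [hv, if_true]
    refine ⟨hasDerivAt_heis_iff.2 ⟨fun i => (hd i).1, fun i => (hd i).2.1, dz⟩,
      hasDerivAt_heis_iff.2 ⟨fun i => ?_, fun i => ?_, hasDerivAt_const _ _⟩, fun w' hw' => ?_⟩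
    · refine ((hd i).2.2.1.fun_add ((hd i).2.1.const_mul (γ / 2))).congr_deriv ?_
      simp only [adjointVelocity]
      ring
    · refine ((hd i).2.2.2.fun_sub ((hd i).1.const_mul (γ / 2))).congr_deriv ?_
      simp only [adjointVelocity]
      ring
    · rw [pontryagin_eq, pontryagin_eq]
      refine (le_of_eq ?_).trans ((hmax w' hw').trans (le_of_eq ?_)) <;>
        exact Finset.sum_congr rfl fun i _ => by ring

/-- The gauges of the horizontal Hamiltonians are constant along an extremal. -/
theorem NormalizedExtremal.polarGauges_eq {U : Set (HVec n)} {Ω : Fin n → Set (ℝ × ℝ)}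
    {μ : (Fin n → ℝ) → ℝ} (hU : SphericalForm U Ω μ) {T : ℝ} (hT : 0 < T)
    {x y : ℝ → Fin n → ℝ} {z : ℝ → ℝ} {γ : ℝ} {h g : ℝ → Fin n → ℝ}
    (hE : NormalizedExtremal U T x y z γ h g) :
    ∀ t ∈ Icc 0 T, polarGauges Ω (h t) (g t) = polarGauges Ω (h 0) (g 0) := by
  intro t ht
  funext i
  have hb := hU.body i
  have hlip : LipOn T fun t => gauge (polarSet (Ω i)) (h t i, g t i) :=
    hb.polar.lipOn_gauge ((hE.lipOn_h i).prodMk (hE.lipOn_g i))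
  refine hlip.eq_of_ae_hasDerivAt_zero hT.le ?_ t ht
  filter_upwards [hE.ae_max, hlip.ae_differentiableAt hT.le] with t ⟨hv, hd, _, hmax⟩ hdiff
  have heq := ((hU.isMax_iff hv (h t) (g t)).1 hmax).2 i
  obtain ⟨-, -, dh, dg⟩ := hd i
  set v : ℝ × ℝ := ((velocity x y t).1 i, (velocity x y t).2 i) with hvdef
  -- A support point of (h_i, g_i) parallel to the velocity v. Since (h_i', g_i') = γ(−v.2, v.1), it
  -- is orthogonal to P. If v = 0, any support point works.
  obtain ⟨P, hP, hPs, hPv⟩ : ∃ P ∈ Ω i, h t i * P.1 + g t i * P.2 =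
      gauge (polarSet (Ω i)) (h t i, g t i) ∧ -(γ * v.2) * P.1 + γ * v.1 * P.2 = 0 := by
    by_cases hv0 : v = 0
    · obtain ⟨P, hP, hPs⟩ := hb.exists_dot_eq_gauge_polar (h t i, g t i)
      exact ⟨P, hP, hPs, by simp [hv0]⟩
    · have hg := hb.gauge_pos hv0
      refine ⟨_, hb.inv_gauge_smul_mem hv0, ?_, ?_⟩
      · simp only [Prod.smul_fst, Prod.smul_snd, smul_eq_mul]
        have heq' : h t i * v.1 + g t i * v.2 =
          gauge (polarSet (Ω i)) (h t i, g t i) * gauge (Ω i) v := heq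
        rw [show h t i * ((gauge (Ω i) v)⁻¹ * v.1) + g t i * ((gauge (Ω i) v)⁻¹ * v.2) =
          (h t i * v.1 + g t i * v.2) * (gauge (Ω i) v)⁻¹ by ring, heq',
          mul_inv_cancel_right₀ hg.ne']
      · simp only [Prod.smul_fst, Prod.smul_snd, smul_eq_mul]
        ring
  -- The linear function of P touches the polar gauge from below at time t, so the two have equal
  -- derivatives along the curve, with no smoothness of the gauge itself.
  have hmin : IsLocalMin (fun s => gauge (polarSet (Ω i)) (h s i, g s i) -
      (h s i * P.1 + g s i * P.2)) t := by
    refine Filter.Eventually.of_forall fun s => ?_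
    simp only [hPs, sub_self, sub_nonneg]
    exact hb.dot_le_gauge_polar hP (h s i, g s i)
  have hderiv := hdiff.hasDerivAt
  have h0 := hmin.hasDerivAt_eq_zero
    (hderiv.fun_sub ((dh.mul_const P.1).fun_add (dg.mul_const P.2)))
  have h1 : -(γ * (velocity x y t).2 i) * P.1 + γ * (velocity x y t).1 i * P.2 = 0 := hPv
  rw [h1, sub_zero] at h0
  rwa [h0] at hderiv


/-! ### From extremals to the parametrization -/

/-- Deleting the coordinates with A_i = 0 does not change Σ A_i l_i, and monotonicity of μ keeps the
vector in Ξ. The result is the default value of λ on exceptional instants. -/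
theorem SphericalForm.exists_mem_subdiff {U : Set (HVec n)} {Ω : Fin n → Set (ℝ × ℝ)}
    {μ : (Fin n → ℝ) → ℝ} (hU : SphericalForm U Ω μ) (A : Fin n → ℝ) :
    ∃ l ∈ subdiff (supportFun (xiSet μ)) A, ∀ i, A i = 0 → l i = 0 := by
  classical
  obtain ⟨m, hm, hms⟩ := hU.exists_sum_eq_supportFun A
  have hnn : ∀ i, 0 ≤ (fun i => if A i = 0 then 0 else m i) i := fun i => by
    by_cases hi : A i = 0
    · simp [hi]
    · simpa [hi] using hm.1 i
  refine ⟨fun i => if A i = 0 then 0 else m i, hU.mem_subdiff_iff.2 ⟨⟨hnn, ?_⟩, ?_⟩, fun i hi => ?_⟩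
  · refine (hU.monotoneOn hnn hm.1 fun i => ?_).trans hm.2
    by_cases hi : A i = 0
    · simpa [hi] using hm.1 i
    · simp [hi]
  · rw [← hms]
    refine Finset.sum_congr rfl fun i _ => ?_
    by_cases hi : A i = 0 <;> simp [hi]
  · simp [hi]

theorem polarGauges_eq_zero_iff {U : Set (HVec n)} {Ω : Fin n → Set (ℝ × ℝ)}
    {μ : (Fin n → ℝ) → ℝ} (hU : SphericalForm U Ω μ) {h g : Fin n → ℝ} {i : Fin n} :
    polarGauges Ω h g i = 0 ↔ h i = 0 ∧ g i = 0 := by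
  constructor
  · intro h0
    by_contra hne
    refine ((hU.body i).polar.gauge_pos (P := (h i, g i)) fun h => hne ?_).ne' h0
    exact ⟨congrArg Prod.fst h, congrArg Prod.snd h⟩
  · rintro ⟨h1, h2⟩
    rw [polarGauges, h1, h2, ← Prod.zero_eq_mk, gauge_zero]

/-- The derivative of the closed formula for 2z equals the horizontal area form. Both directions use
it for γ ≠ 0. -/
theorem sum_vertical_eq {ι : Type*} [Fintype ι] {γ S : ℝ} {h g h₀ g₀ x y u v : ι → ℝ}
    (hx : ∀ i, x i = γ * (g i - g₀ i)) (hy : ∀ i, y i = γ * (h₀ i - h i))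
    (hs : ∑ i, (h i * u i + g i * v i) = S) :
    γ * S + ∑ i, (g₀ i * -(γ * v i) - h₀ i * (γ * u i)) = ∑ i, (x i * v i - y i * u i) := by
  rw [← hs, Finset.mul_sum, ← Finset.sum_add_distrib]
  refine Finset.sum_congr rfl fun i _ => ?_
  rw [hx, hy]
  ring

namespace NormalizedExtremal

variable {U : Set (HVec n)} {Ω : Fin n → Set (ℝ × ℝ)} {μ : (Fin n → ℝ) → ℝ} {T : ℝ}
  {x y : ℝ → Fin n → ℝ} {z : ℝ → ℝ} {γ : ℝ} {h g : ℝ → Fin n → ℝ}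

/-- λ is the vector of gauges of the velocity. The constraints on it are required at every instant,
so it is replaced by a fixed admissible value where they fail. -/
theorem exists_gauges (hE : NormalizedExtremal U T x y z γ h g) (hU : SphericalForm U Ω μ)
    (hT : 0 < T) :
    ∃ l : ℝ → Fin n → ℝ, Measurable l ∧
      (∀ t, l t ∈ subdiff (supportFun (xiSet μ)) (polarGauges Ω (h 0) (g 0))) ∧
      (∀ i, polarGauges Ω (h 0) (g 0) i = 0 ∧ γ ≠ 0 → ∀ t, l t i = 0) ∧
      ∀ᵐ t ∂(volume.restrict (Icc 0 T)), l t = gauges Ω (velocity x y t) ∧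
        ∀ i, h t i * (velocity x y t).1 i + g t i * (velocity x y t).2 i =
          polarGauges Ω (h 0) (g 0) i * l t i := by
  classical
  set A := polarGauges Ω (h 0) (g 0) with hA
  have hAc := hE.polarGauges_eq hU hT
  set S : Set (Fin n → ℝ) :=
    subdiff (supportFun (xiSet μ)) A ∩ {l | ∀ i, A i = 0 ∧ γ ≠ 0 → l i = 0} with hS
  have hSm : MeasurableSet S := by
    refine (hU.measurableSet_subdiff A).inter (IsClosed.measurableSet ?_)
    simp only [ofPred_forall]
    exact isClosed_iInter fun i => isClosed_iInter fun _ =>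
      isClosed_eq (continuous_apply i) continuous_const
  obtain ⟨l₀, hl₀, hl₀z⟩ := hU.exists_mem_subdiff A
  have hl₀S : l₀ ∈ S := ⟨hl₀, fun i hi => hl₀z i hi.1⟩
  have hgm : Measurable fun t => gauges Ω (velocity x y t) :=
    hU.continuous_gauges.measurable.comp (measurable_velocity x y)
  set l : ℝ → Fin n → ℝ := fun t =>
    if gauges Ω (velocity x y t) ∈ S then gauges Ω (velocity x y t) else l₀ with hl
  have hlS : ∀ t, l t ∈ S := by
    intro t
    by_cases ht : gauges Ω (velocity x y t) ∈ S
    · simp only [hl, ht, if_true]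
    · simp only [hl, ht, if_false, hl₀S]
  refine ⟨l, Measurable.ite (hgm hSm) hgm measurable_const, fun t => (hlS t).1,
    fun i hi t => (hlS t).2 i hi, ?_⟩
  filter_upwards [hE.ae_max, ae_mem_Ioo T] with t ⟨hv, hd, _, hmax⟩ ht
  obtain ⟨h1, h2⟩ := (hU.isMax_iff hv (h t) (g t)).1 hmax
  rw [hAc t (Ioo_subset_Icc_self ht)] at h1 h2
  have hmem : gauges Ω (velocity x y t) ∈ S := by
    refine ⟨h1, fun i hi => ?_⟩
    -- A_i = 0 makes h_i and g_i vanish identically. Their derivatives are −γ v_i and γ u_i, so for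
    -- γ ≠ 0 the velocity in this plane is zero.
    have hz : ∀ s ∈ Icc 0 T, h s i = 0 ∧ g s i = 0 := fun s hs => by
      rw [← polarGauges_eq_zero_iff hU, hAc s hs]
      exact hi.1
    have e1 := (hd i).2.2.1.unique
      (hasDerivAt_congr_Icc ht (fun s hs => (hz s hs).1) (hasDerivAt_const t (0 : ℝ)))
    have e2 := (hd i).2.2.2.unique
      (hasDerivAt_congr_Icc ht (fun s hs => (hz s hs).2) (hasDerivAt_const t (0 : ℝ)))
    rw [neg_eq_zero, mul_eq_zero, or_iff_right hi.2] at e1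
    rw [mul_eq_zero, or_iff_right hi.2] at e2
    rw [gauges, e1, e2, ← Prod.zero_eq_mk, gauge_zero]
  have hlt : l t = gauges Ω (velocity x y t) := by simp only [hl, hmem, if_true]
  exact ⟨hlt, fun i => by rw [hlt, h2 i]⟩

theorem exists_initial_angles (hU : SphericalForm U Ω μ) (h₀ g₀ : Fin n → ℝ) :
    ∃ θ₀ : Fin n → ℝ, ∀ i, 0 < polarGauges Ω h₀ g₀ i →
      anglePoint (polarSet (Ω i)) (θ₀ i) =
        (h₀ i / polarGauges Ω h₀ g₀ i, g₀ i / polarGauges Ω h₀ g₀ i) := by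
  choose a _ ha using fun i => (hU.body i).polar.exists_measurable_angle
  refine ⟨fun i => a i (h₀ i / polarGauges Ω h₀ g₀ i, g₀ i / polarGauges Ω h₀ g₀ i),
    fun i hi => ha i _ ?_⟩
  rw [show (h₀ i / polarGauges Ω h₀ g₀ i, g₀ i / polarGauges Ω h₀ g₀ i) =
    (polarGauges Ω h₀ g₀ i)⁻¹ • ((h₀ i, g₀ i) : ℝ × ℝ) by
      simp [Prod.smul_mk, div_eq_inv_mul], gauge_smul_of_nonneg (inv_nonneg.2 hi.le), smul_eq_mul]
  exact inv_mul_cancel₀ hi.ne'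

theorem parametrization_of_ne_zero (hE : NormalizedExtremal U T x y z γ h g)
    (hU : SphericalForm U Ω μ) (hT : 0 < T) (hγ : γ ≠ 0) :
    ∃ (A θ₀ : Fin n → ℝ) (l : ℝ → Fin n → ℝ), (∀ i, 0 ≤ A i) ∧ Measurable l ∧
      (∀ t ∈ Icc 0 T, l t ∈ subdiff (supportFun (xiSet μ)) A) ∧
      (∀ i, A i = 0 ∧ γ ≠ 0 → ∀ t ∈ Icc 0 T, l t i = 0) ∧
      ∀ t ∈ Icc 0 T,
        (∀ i, 0 < A i →
          x t i = γ * A i * (sinOf (polarSet (Ω i)) (polarAngle γ A θ₀ l i t)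
            - sinOf (polarSet (Ω i)) (θ₀ i)) ∧
          y t i = γ * A i * (cosOf (polarSet (Ω i)) (θ₀ i)
            - cosOf (polarSet (Ω i)) (polarAngle γ A θ₀ l i t))) ∧
        (∀ i, A i = 0 → x t i = 0 ∧ y t i = 0) ∧
        2 * z t = γ * supportFun (xiSet μ) A * t +
          ∑ i with 0 < A i, A i ^ 2 *
            (sinOf (polarSet (Ω i)) (θ₀ i) *
                cosOf (polarSet (Ω i)) (polarAngle γ A θ₀ l i t)
              - cosOf (polarSet (Ω i)) (θ₀ i) *
                sinOf (polarSet (Ω i)) (polarAngle γ A θ₀ l i t)) := by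
  have hγ2 : γ * γ = 1 := by
    rcases hE.vertical with h0 | h0 | h0
    · exact absurd h0 hγ
    · rw [h0, mul_one]
    · rw [h0]; norm_num
  obtain ⟨l, hlm, hls, hlz, hlae⟩ := hE.exists_gauges hU hT
  obtain ⟨θ₀, hθ₀⟩ := exists_initial_angles hU (h 0) (g 0)
  have hAc := hE.polarGauges_eq hU hT
  have hA0 : ∀ i, 0 ≤ polarGauges Ω (h 0) (g 0) i := fun i => gauge_nonneg _
  set A := polarGauges Ω (h 0) (g 0) with hA
  obtain ⟨M, hM⟩ := hU.exists_abs_le_of_mem_subdiff A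
  have hlb : ∀ i, ∀ t ∈ Icc 0 T, |l t i| ≤ M := fun i t _ => hM _ (hls t) i
  have hlmi : ∀ i, Measurable fun t => l t i := fun i => (measurable_pi_apply i).comp hlm
  have hgx : ∀ t ∈ Icc 0 T, ∀ i, x t i = γ * (g t i - g 0 i) := by
    intro t ht i
    have hc := LipOn.eq_of_ae_hasDerivAt (f' := fun t => γ * (velocity x y t).1 i) hT.le
      (hE.lipOn_g i) ((LipOn.const (g 0 i)).add ((hE.lipOn_x i).const_mul γ))
      (by rw [hE.x_zero, mul_zero, add_zero]) (by
        filter_upwards [hE.ae_max] with t ht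
        exact ⟨(ht.2.1 i).2.2.2, ((ht.2.1 i).1.const_mul γ).const_add _⟩) t ht
    rw [hc]; linear_combination -(x t i) * hγ2
  have hhy : ∀ t ∈ Icc 0 T, ∀ i, y t i = γ * (h 0 i - h t i) := by
    intro t ht i
    have hc := LipOn.eq_of_ae_hasDerivAt (f' := fun t => -(γ * (velocity x y t).2 i)) hT.le
      (hE.lipOn_h i) ((LipOn.const (h 0 i)).add ((hE.lipOn_y i).const_mul γ).neg)
      (by rw [hE.y_zero, mul_zero, neg_zero, add_zero]) (by
        filter_upwards [hE.ae_max] with t ht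
        exact ⟨(ht.2.1 i).2.2.1, (((ht.2.1 i).2.1.const_mul γ).fun_neg).const_add _⟩) t ht
    rw [hc]; linear_combination -(y t i) * hγ2
  have hangle : ∀ i, 0 < A i → ∀ t ∈ Icc 0 T,
      anglePoint (polarSet (Ω i)) (polarAngle γ A θ₀ l i t) = (h t i / A i, g t i / A i) := by
    intro i hi
    have hb := (hU.body i).polar
    refine hb.anglePoint_eq_of_cross_deriv hT.le (a := fun t => h t i / A i)
      (b := fun t => g t i / A i) (θ := polarAngle γ A θ₀ l i) ?_ ?_ ?_ ?_ ?_ ?_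
    · exact ((hE.lipOn_h i).const_mul (A i)⁻¹).congr fun t _ => by rw [div_eq_inv_mul]
    · exact ((hE.lipOn_g i).const_mul (A i)⁻¹).congr fun t _ => by rw [div_eq_inv_mul]
    · exact (LipOn.const (θ₀ i)).add ((LipOn.integral hT.le (hlmi i) (hlb i)).const_mul _)
    · intro t ht
      have e : (h t i / A i, g t i / A i) = (A i)⁻¹ • ((h t i, g t i) : ℝ × ℝ) := by
        simp [Prod.smul_mk, div_eq_inv_mul]
      rw [e, gauge_smul_of_nonneg (inv_nonneg.2 hi.le), smul_eq_mul]
      have e2 : gauge (polarSet (Ω i)) (h t i, g t i) = A i := congrFun (hAc t ht) i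
      rw [e2, inv_mul_cancel₀ hi.ne']
    · rw [polarAngle, intervalIntegral.integral_same, mul_zero, add_zero]
      exact hθ₀ i hi
    · filter_upwards [hE.ae_max, hlae, ae_hasDerivAt_integral hT.le (hlmi i) (hlb i)]
        with t h1 h2 h3
      refine ⟨_, _, ((h1.2.1 i).2.2.1).div_const (A i), ((h1.2.1 i).2.2.2).div_const (A i),
        ((h3.const_mul (γ / A i)).const_add (θ₀ i)).congr_deriv ?_⟩
      -- The cross product of (h_i, g_i)/A_i with its velocity is γ(h_i u_i + g_i v_i)/A_i², which
      -- equals γ λ_i/A_i by duality.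
      have h4 := h2.2 i
      field_simp
      linear_combination -h4
  refine ⟨A, θ₀, l, hA0, hlm, fun t _ => hls t, fun i hi t _ => hlz i hi t, fun t ht => ?_⟩
  have hcs : ∀ i, 0 < A i → A i * cosOf (polarSet (Ω i)) (polarAngle γ A θ₀ l i t) = h t i ∧
      A i * sinOf (polarSet (Ω i)) (polarAngle γ A θ₀ l i t) = g t i ∧
      A i * cosOf (polarSet (Ω i)) (θ₀ i) = h 0 i ∧
      A i * sinOf (polarSet (Ω i)) (θ₀ i) = g 0 i := by
    intro i hi
    rw [cosOf, sinOf, cosOf, sinOf, hangle i hi t ht, hθ₀ i hi]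
    exact ⟨mul_div_cancel₀ _ hi.ne', mul_div_cancel₀ _ hi.ne', mul_div_cancel₀ _ hi.ne',
      mul_div_cancel₀ _ hi.ne'⟩
  have hzero : ∀ t ∈ Icc 0 T, ∀ i, A i = 0 → h t i = 0 ∧ g t i = 0 := fun t ht i hi => by
    rw [← polarGauges_eq_zero_iff hU, hAc t ht]
    exact hi
  have h00 : (0 : ℝ) ∈ Icc 0 T := ⟨le_rfl, hT.le⟩
  refine ⟨fun i hi => ?_, fun i hi => ?_, ?_⟩
  · obtain ⟨e1, e2, e3, e4⟩ := hcs i hi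
    rw [hgx t ht i, hhy t ht i, ← e1, ← e2, ← e3, ← e4]
    constructor <;> ring
  · obtain ⟨e1, e2⟩ := hzero t ht i hi
    obtain ⟨e3, e4⟩ := hzero 0 h00 i hi
    rw [hgx t ht i, hhy t ht i, e1, e2, e3, e4]
    simp
  -- Both sides vanish at 0 and have the same a.e. derivative; Σ A_i λ_i = s_Ξ(A) accounts for the
  -- linear term.
  · have hz := LipOn.eq_of_ae_hasDerivAt
      (f' := fun t => ∑ i, (x t i * (velocity x y t).2 i - y t i * (velocity x y t).1 i)) hT.le
      (hE.lipOn_z.const_mul 2)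
      (((LipOn.id (T := T)).const_mul (γ * supportFun (xiSet μ) A)).add
        (LipOn.sum Finset.univ fun i =>
          ((hE.lipOn_h i).const_mul (g 0 i)).sub ((hE.lipOn_g i).const_mul (h 0 i))))
      (by
        rw [hE.z_zero, mul_zero, mul_zero, zero_add]
        exact (Finset.sum_eq_zero fun i _ => by ring).symm) (by
        filter_upwards [hE.ae_max, hlae, ae_mem_Ioo T] with t ⟨_, hd, dz, _⟩ h2 ht
        have htc := Ioo_subset_Icc_self ht
        refine ⟨(dz.const_mul 2).congr_deriv (by ring), ?_⟩
        refine (((hasDerivAt_id t).const_mul (γ * supportFun (xiSet μ) A)).fun_add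
          (HasDerivAt.fun_sum fun i _ => ((hd i).2.2.1.const_mul (g 0 i)).fun_sub
            ((hd i).2.2.2.const_mul (h 0 i)))).congr_deriv ?_
        rw [mul_one]
        refine sum_vertical_eq (hgx t htc) (hhy t htc) ?_
        rw [Finset.sum_congr rfl fun i _ => h2.2 i]
        exact (hU.mem_subdiff_iff.1 (hls t)).2) t ht
    rw [hz, Finset.sum_filter]
    congr 1
    refine Finset.sum_congr rfl fun i _ => ?_
    by_cases hi : 0 < A i
    · obtain ⟨e1, e2, e3, e4⟩ := hcs i hi
      rw [if_pos hi, ← e1, ← e2, ← e3, ← e4]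
      ring
    · have hi0 : A i = 0 := le_antisymm (not_lt.1 hi) (hA0 i)
      obtain ⟨e1, e2⟩ := hzero t ht i hi0
      rw [if_neg hi, e1, e2]
      simp

theorem parametrization_of_eq_zero (hE : NormalizedExtremal U T x y z γ h g)
    (hU : SphericalForm U Ω μ) (hT : 0 < T) (hγ : γ = 0) :
    ∃ (A θ₀ : Fin n → ℝ) (l : ℝ → Fin n → ℝ), (∀ i, 0 ≤ A i) ∧ A ≠ 0 ∧ Measurable l ∧
      (∀ t ∈ Icc 0 T, l t ∈ subdiff (supportFun (xiSet μ)) A) ∧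
      ∃ θ : ℝ → Fin n → ℝ, Measurable θ ∧
        (∀ i, 0 < A i → ∀ t ∈ Icc 0 T, Corresponds (Ω i) (θ t i) (θ₀ i)) ∧
        ∀ t ∈ Icc 0 T,
          (∀ i, x t i = ∫ τ in (0 : ℝ)..t, l τ i * cosOf (Ω i) (θ τ i)) ∧
          (∀ i, y t i = ∫ τ in (0 : ℝ)..t, l τ i * sinOf (Ω i) (θ τ i)) ∧
          z t = (1 / 2) * ∫ τ in (0 : ℝ)..t, ∑ i,
            (x τ i * deriv (fun s => y s i) τ - deriv (fun s => x s i) τ * y τ i) := by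
  classical
  obtain ⟨l, hlm, hls, -, hlae⟩ := hE.exists_gauges hU hT
  obtain ⟨θ₀, hθ₀⟩ := exists_initial_angles hU (h 0) (g 0)
  have hA0 : ∀ i, 0 ≤ polarGauges Ω (h 0) (g 0) i := fun i => gauge_nonneg _
  have h00 : (0 : ℝ) ∈ Icc 0 T := ⟨le_rfl, hT.le⟩
  have hAne : polarGauges Ω (h 0) (g 0) ≠ 0 := fun hc =>
    hE.nontrivial hγ 0 h00
      ⟨funext fun i => ((polarGauges_eq_zero_iff hU).1 (congrFun hc i)).1,
        funext fun i => ((polarGauges_eq_zero_iff hU).1 (congrFun hc i)).2⟩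
  set A := polarGauges Ω (h 0) (g 0) with hA
  have hh : ∀ t ∈ Icc 0 T, ∀ i, h t i = h 0 i := fun t ht i => by
    refine (hE.lipOn_h i).eq_of_ae_hasDerivAt_zero hT.le ?_ t ht
    filter_upwards [hE.ae_max] with t ht
    exact (ht.2.1 i).2.2.1.congr_deriv (by rw [hγ, zero_mul, neg_zero])
  have hg : ∀ t ∈ Icc 0 T, ∀ i, g t i = g 0 i := fun t ht i => by
    refine (hE.lipOn_g i).eq_of_ae_hasDerivAt_zero hT.le ?_ t ht
    filter_upwards [hE.ae_max] with t ht
    exact (ht.2.1 i).2.2.2.congr_deriv (by rw [hγ, zero_mul])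
  choose a ham ha using fun i => (hU.body i).exists_measurable_angle
  choose P hP hPs using fun i => (hU.body i).exists_dot_eq_gauge_polar (h 0 i, g 0 i)
  have hcorr : ∀ i, 0 < A i → ∀ θ : ℝ, h 0 i * cosOf (Ω i) θ + g 0 i * sinOf (Ω i) θ = A i →
      Corresponds (Ω i) θ (θ₀ i) := by
    intro i hi θ hθ R hR
    rw [cosOf, sinOf, hθ₀ i hi]
    simp only
    have h1 := (hU.body i).dot_le_gauge_polar hR (h 0 i, g 0 i)
    have h2 : h 0 i * R.1 + g 0 i * R.2 ≤ A i := h1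
    rw [← hθ] at h2
    have h3 := div_le_div_of_nonneg_right h2 hi.le
    rw [add_div, add_div] at h3
    rw [div_mul_eq_mul_div, div_mul_eq_mul_div, div_mul_eq_mul_div, div_mul_eq_mul_div]
    exact h3
  set v : ℝ → Fin n → ℝ × ℝ := fun t i => ((velocity x y t).1 i, (velocity x y t).2 i) with hv
  have hvm : ∀ i, Measurable fun t => v t i := fun i =>
    ((measurable_pi_apply i).comp (measurable_velocity x y).fst).prodMk
      ((measurable_pi_apply i).comp (measurable_velocity x y).snd)
  have hgvm : ∀ i, Measurable fun t => gauge (Ω i) (v t i) := fun i =>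
    (hU.body i).continuous_gauge.measurable.comp (hvm i)
  -- Instants with nonzero velocity and equality in the duality: there θ_i is the angle of the
  -- normalized velocity. Elsewhere it is the angle of a fixed support point, so that the
  -- correspondence holds at every instant.
  set good : Fin n → Set ℝ := fun i => {t | 0 < gauge (Ω i) (v t i)} ∩
    {t | h 0 i * (v t i).1 + g 0 i * (v t i).2 = A i * gauge (Ω i) (v t i)} with hgood
  have hgoodm : ∀ i, MeasurableSet (good i) := fun i =>
    (measurableSet_lt measurable_const (hgvm i)).inter
      (measurableSet_eq_fun (((hvm i).fst.const_mul _).add ((hvm i).snd.const_mul _))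
        ((hgvm i).const_mul _))
  set θ : ℝ → Fin n → ℝ := fun t i =>
    if t ∈ good i then a i ((gauge (Ω i) (v t i))⁻¹ • v t i) else a i (P i) with hθ
  have hθgood : ∀ i t, t ∈ good i →
      anglePoint (Ω i) (θ t i) = (gauge (Ω i) (v t i))⁻¹ • v t i := by
    intro i t ht
    simp only [hθ, ht, if_true]
    refine ha i _ ?_
    rw [gauge_smul_of_nonneg (inv_nonneg.2 ht.1.le), smul_eq_mul, inv_mul_cancel₀ ht.1.ne']
  have hθm : Measurable θ := measurable_pi_lambda _ fun i =>
    Measurable.ite (hgoodm i) ((ham i).comp ((hgvm i).inv.smul (hvm i))) measurable_const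
  have hvel : ∀ᵐ t ∂(volume.restrict (Icc 0 T)), ∀ i,
      l t i * cosOf (Ω i) (θ t i) = (velocity x y t).1 i ∧
      l t i * sinOf (Ω i) (θ t i) = (velocity x y t).2 i := by
    filter_upwards [hlae, ae_mem_Ioo T] with t ⟨h1, h2⟩ ht i
    have htc := Ioo_subset_Icc_self ht
    have h3 := h2 i
    have hli : l t i = gauge (Ω i) (v t i) := congrFun h1 i
    rw [hli, hh t htc, hg t htc] at h3
    -- Where the velocity in this plane vanishes, λ_i = 0 and the choice of θ_i is immaterial.
    rcases (gauge_nonneg (s := Ω i) (v t i)).eq_or_lt with h0 | hpos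
    · have hv0 : v t i = 0 := by
        by_contra hne
        exact ((hU.body i).gauge_pos hne).ne h0
      have e1 : (velocity x y t).1 i = 0 := congrArg Prod.fst hv0
      have e2 : (velocity x y t).2 i = 0 := congrArg Prod.snd hv0
      rw [hli, ← h0, e1, e2, zero_mul, zero_mul]
      exact ⟨rfl, rfl⟩
    · have hmem : t ∈ good i := ⟨hpos, h3⟩
      rw [cosOf, sinOf, hθgood i t hmem, hli]
      simp only [Prod.smul_fst, Prod.smul_snd, smul_eq_mul]
      exact ⟨mul_inv_cancel_left₀ hpos.ne' _, mul_inv_cancel_left₀ hpos.ne' _⟩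
  refine ⟨A, θ₀, l, hA0, hAne, hlm, fun t _ => hls t, θ, hθm, fun i hi t _ => hcorr i hi _ ?_,
    fun t ht => ⟨fun i => ?_, fun i => ?_, ?_⟩⟩
  · by_cases hmem : t ∈ good i
    · rw [cosOf, sinOf, hθgood i t hmem]
      simp only [Prod.smul_fst, Prod.smul_snd, smul_eq_mul]
      have e : h 0 i * (v t i).1 + g 0 i * (v t i).2 = A i * gauge (Ω i) (v t i) := hmem.2
      rw [show h 0 i * ((gauge (Ω i) (v t i))⁻¹ * (v t i).1) +
        g 0 i * ((gauge (Ω i) (v t i))⁻¹ * (v t i).2) =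
        (h 0 i * (v t i).1 + g 0 i * (v t i).2) * (gauge (Ω i) (v t i))⁻¹ by ring, e,
        mul_inv_cancel_right₀ hmem.1.ne']
    · have hPi : h 0 i * (P i).1 + g 0 i * (P i).2 = A i := hPs i
      -- A_i > 0 forces the support point onto the boundary, so it has an angle.
      have hP1 : gauge (Ω i) (P i) = 1 := by
        refine le_antisymm ((hU.body i).mem_iff_gauge_le_one.1 (hP i)) ?_
        have h1 : h 0 i * (P i).1 + g 0 i * (P i).2 ≤ A i * gauge (Ω i) (P i) :=
          (hU.body i).dot_le_gauge_mul_gauge (h 0 i, g 0 i) (P i)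
        rw [hPi] at h1
        exact le_of_mul_le_mul_left (by rwa [mul_one]) hi
      simp only [cosOf, sinOf, hθ, hmem, if_false, ha i (P i) hP1]
      exact hPi
  · rw [(hE.lipOn_x i).integral_eq_sub (by
      filter_upwards [hE.ae_max, hvel] with t h1 h2
      exact (h1.2.1 i).1.congr_deriv (h2 i).1.symm) t ht, hE.x_zero, sub_zero]
  · rw [(hE.lipOn_y i).integral_eq_sub (by
      filter_upwards [hE.ae_max, hvel] with t h1 h2
      exact (h1.2.1 i).2.1.congr_deriv (h2 i).2.symm) t ht, hE.y_zero, sub_zero]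
  · rw [(hE.lipOn_z.const_mul 2).integral_eq_sub (by
      filter_upwards [hE.ae_max] with t h1
      refine (h1.2.2.1.const_mul 2).congr_deriv ?_
      rw [← mul_assoc, show (2 : ℝ) * (1 / 2) = 1 by norm_num, one_mul]
      exact Finset.sum_congr rfl fun i _ => by rw [mul_comm (y t i)]; rfl) t ht, hE.z_zero]
    ring

end NormalizedExtremal


/-! ### From the parametrization to extremals -/

namespace SphericalForm

variable {U : Set (HVec n)} {Ω : Fin n → Set (ℝ × ℝ)} {μ : (Fin n → ℝ) → ℝ} {T : ℝ}
  {x y : ℝ → Fin n → ℝ} {z : ℝ → ℝ} {γ : ℝ} {A θ₀ : Fin n → ℝ} {l : ℝ → Fin n → ℝ}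

theorem isMax_of_gauges_mem (hU : SphericalForm U Ω μ) {w : HVec n} {h g lt : Fin n → ℝ}
    (hw : gauges Ω w = lt) (hl : lt ∈ subdiff (supportFun (xiSet μ)) A)
    (hA : polarGauges Ω h g = A) (hs : ∀ i, h i * w.1 i + g i * w.2 i = A i * lt i) :
    w ∈ U ∧ ∀ w' ∈ U, ∑ i, (h i * w'.1 i + g i * w'.2 i) ≤
      ∑ i, (h i * w.1 i + g i * w.2 i) := by
  have hwU : w ∈ U := hU.mem_iff.2 (by rw [hw]; exact (hU.mem_subdiff_iff.1 hl).1)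
  refine ⟨hwU, (hU.isMax_iff hwU h g).2 ?_⟩
  rw [hA, hw]
  exact ⟨hl, hs⟩

theorem polarGauges_mul_anglePoint (hU : SphericalForm U Ω μ) (hA : ∀ i, 0 ≤ A i)
    (θ : Fin n → ℝ) :
    polarGauges Ω (fun i => A i * cosOf (polarSet (Ω i)) (θ i))
      (fun i => A i * sinOf (polarSet (Ω i)) (θ i)) = A := by
  funext i
  have e : (A i * cosOf (polarSet (Ω i)) (θ i), A i * sinOf (polarSet (Ω i)) (θ i)) =
      A i • anglePoint (polarSet (Ω i)) (θ i) := rfl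
  rw [polarGauges, e, gauge_smul_of_nonneg (hA i), (hU.body i).polar.gauge_anglePoint, smul_eq_mul,
    mul_one]

theorem normalizedExtremal_of_ne_zero (hU : SphericalForm U Ω μ) (hT : 0 < T)
    (hγ : γ = 1 ∨ γ = -1) (hA : ∀ i, 0 ≤ A i) (hlm : Measurable l)
    (hl : ∀ t ∈ Icc 0 T, l t ∈ subdiff (supportFun (xiSet μ)) A)
    (hl0 : ∀ i, A i = 0 → ∀ t ∈ Icc 0 T, l t i = 0)
    (hxy : ∀ t ∈ Icc 0 T, ∀ i, 0 < A i →
      x t i = γ * A i * (sinOf (polarSet (Ω i)) (polarAngle γ A θ₀ l i t)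
        - sinOf (polarSet (Ω i)) (θ₀ i)) ∧
      y t i = γ * A i * (cosOf (polarSet (Ω i)) (θ₀ i)
        - cosOf (polarSet (Ω i)) (polarAngle γ A θ₀ l i t)))
    (hxy0 : ∀ t ∈ Icc 0 T, ∀ i, A i = 0 → x t i = 0 ∧ y t i = 0)
    (hz : ∀ t ∈ Icc 0 T, 2 * z t = γ * supportFun (xiSet μ) A * t +
      ∑ i with 0 < A i, A i ^ 2 *
        (sinOf (polarSet (Ω i)) (θ₀ i) * cosOf (polarSet (Ω i)) (polarAngle γ A θ₀ l i t)
          - cosOf (polarSet (Ω i)) (θ₀ i) *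
            sinOf (polarSet (Ω i)) (polarAngle γ A θ₀ l i t))) :
    NormalizedExtremal U T x y z γ
      (fun t i => A i * cosOf (polarSet (Ω i)) (polarAngle γ A θ₀ l i t))
      (fun t i => A i * sinOf (polarSet (Ω i)) (polarAngle γ A θ₀ l i t)) := by
  have hγ0 : γ ≠ 0 := by rcases hγ with h | h <;> rw [h] <;> norm_num
  have hγ2 : γ * γ = 1 := by rcases hγ with h | h <;> rw [h] <;> norm_num
  obtain ⟨M, hM⟩ := hU.exists_abs_le_of_mem_subdiff A
  have hlb : ∀ i, ∀ t ∈ Icc 0 T, |l t i| ≤ M := fun i t ht => hM _ (hl t ht) i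
  have hlmi : ∀ i, Measurable fun t => l t i := fun i => (measurable_pi_apply i).comp hlm
  have hangle : ∀ i, LipOn T (polarAngle γ A θ₀ l i) := fun i =>
    (LipOn.const (θ₀ i)).add ((LipOn.integral hT.le (hlmi i) (hlb i)).const_mul _)
  have hangle0 : ∀ i, polarAngle γ A θ₀ l i 0 = θ₀ i := fun i => by
    rw [polarAngle, intervalIntegral.integral_same, mul_zero, add_zero]
  set h : ℝ → Fin n → ℝ :=
    fun t i => A i * cosOf (polarSet (Ω i)) (polarAngle γ A θ₀ l i t) with hh
  set g : ℝ → Fin n → ℝ :=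
    fun t i => A i * sinOf (polarSet (Ω i)) (polarAngle γ A θ₀ l i t) with hg
  have hlip : ∀ i, LipOn T (fun t => cosOf (polarSet (Ω i)) (polarAngle γ A θ₀ l i t)) ∧
      LipOn T (fun t => sinOf (polarSet (Ω i)) (polarAngle γ A θ₀ l i t)) := fun i =>
    (hU.body i).polar.lipOn_anglePoint (hangle i)
  have hlh : ∀ i, LipOn T fun t => h t i := fun i => (hlip i).1.const_mul _
  have hlg : ∀ i, LipOn T fun t => g t i := fun i => (hlip i).2.const_mul _
  have hx : ∀ t ∈ Icc 0 T, ∀ i, x t i = γ * (g t i - g 0 i) := by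
    intro t ht i
    rcases (hA i).eq_or_lt with hi | hi
    · rw [(hxy0 t ht i hi.symm).1]; simp only [hg, ← hi]; ring
    · rw [(hxy t ht i hi).1]; simp only [hg, hangle0]; ring
  have hy : ∀ t ∈ Icc 0 T, ∀ i, y t i = γ * (h 0 i - h t i) := by
    intro t ht i
    rcases (hA i).eq_or_lt with hi | hi
    · rw [(hxy0 t ht i hi.symm).2]; simp only [hh, ← hi]; ring
    · rw [(hxy t ht i hi).2]; simp only [hh, hangle0]; ring
  have hz' : ∀ t ∈ Icc 0 T, z t = 1 / 2 * (γ * supportFun (xiSet μ) A * t +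
      ∑ i, (g 0 i * h t i - h 0 i * g t i)) := by
    intro t ht
    have e : ∑ i, (g 0 i * h t i - h 0 i * g t i) = ∑ i with 0 < A i, A i ^ 2 *
        (sinOf (polarSet (Ω i)) (θ₀ i) * cosOf (polarSet (Ω i)) (polarAngle γ A θ₀ l i t)
          - cosOf (polarSet (Ω i)) (θ₀ i) *
            sinOf (polarSet (Ω i)) (polarAngle γ A θ₀ l i t)) := by
      rw [Finset.sum_filter]
      refine Finset.sum_congr rfl fun i _ => ?_
      by_cases hi : 0 < A i
      · rw [if_pos hi]; simp only [hh, hg, hangle0]; ring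
      · have hi0 : A i = 0 := le_antisymm (not_lt.1 hi) (hA i)
        rw [if_neg hi]; simp only [hh, hg, hi0]; ring
    rw [e, ← hz t ht]; ring
  have h00 : (0 : ℝ) ∈ Icc 0 T := ⟨le_rfl, hT.le⟩
  refine ⟨Or.inr hγ, fun i => ?_, fun i => ?_, ?_, fun i => ?_, fun i => ?_, ?_, hlh, hlg,
    fun hc => absurd hc hγ0, ?_⟩
  · rw [hx 0 h00, sub_self, mul_zero]
  · rw [hy 0 h00, sub_self, mul_zero]
  · rw [hz' 0 h00, mul_zero, zero_add, Finset.sum_eq_zero fun i _ => by ring, mul_zero]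
  · exact (((hlg i).sub (LipOn.const _)).const_mul γ).congr fun t ht => hx t ht i
  · exact (((LipOn.const _).sub (hlh i)).const_mul γ).congr fun t ht => hy t ht i
  · exact ((((LipOn.id (T := T)).const_mul (γ * supportFun (xiSet μ) A)).add
      (LipOn.sum Finset.univ fun i =>
        ((hlh i).const_mul (g 0 i)).sub ((hlg i).const_mul (h 0 i)))).const_mul (1 / 2)).congr hz'
  · have hae : ∀ᵐ t ∂(volume.restrict (Icc 0 T)), ∀ i,
        HasDerivAt (fun t => ∫ τ in (0 : ℝ)..t, l τ i) (l t i) t ∧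
        DifferentiableAt ℝ (fun t => cosOf (polarSet (Ω i)) (polarAngle γ A θ₀ l i t)) t ∧
        DifferentiableAt ℝ (fun t => sinOf (polarSet (Ω i)) (polarAngle γ A θ₀ l i t)) t := by
      rw [ae_all_iff]
      intro i
      filter_upwards [ae_hasDerivAt_integral hT.le (hlmi i) (hlb i),
        (hlip i).1.ae_differentiableAt hT.le, (hlip i).2.ae_differentiableAt hT.le]
        with t h1 h2 h3 using ⟨h1, h2, h3⟩
    filter_upwards [hae, ae_mem_Ioo T] with t hd ht
    have htc := Ioo_subset_Icc_self ht
    -- P is a support point of the covector, and (h_i', g_i') is γ λ_i times P rotated by a right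
    -- angle. Hence the planar velocity is λ_i P.
    have key : ∀ i, ∃ P : ℝ × ℝ, HasDerivAt (fun s => h s i) (-(γ * (l t i * P.2))) t ∧
        HasDerivAt (fun s => g s i) (γ * (l t i * P.1)) t ∧
        h t i * (l t i * P.1) + g t i * (l t i * P.2) = A i * l t i ∧
        gauge (Ω i) (l t i • P) = l t i := by
      intro i
      have hb := hU.body i
      rcases (hA i).eq_or_lt with hi | hi
      · refine ⟨0, ?_, ?_, ?_, ?_⟩
        · simp only [hh, ← hi, zero_mul, Prod.snd_zero, mul_zero, neg_zero]
          exact hasDerivAt_const t 0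
        · simp only [hg, ← hi, zero_mul, Prod.fst_zero, mul_zero]
          exact hasDerivAt_const t 0
        · rw [← hi]; simp
        -- With A_i = 0 the component stays at rest; this needs λ_i = 0, since the gauges of the
        -- velocity must be exactly λ.
        · rw [hl0 i hi.symm t htc, smul_zero, gauge_zero]
      · obtain ⟨d1, d2, d3⟩ := hd i
        have dθ : HasDerivAt (polarAngle γ A θ₀ l i) (γ / A i * l t i) t :=
          (d1.const_mul _).const_add _
        have hcross := hb.polar.cross_deriv_anglePoint dθ d2.hasDerivAt d3.hasDerivAt
        obtain ⟨P, hP, hPs⟩ :=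
          hb.exists_dot_eq_gauge_polar (anglePoint (polarSet (Ω i)) (polarAngle γ A θ₀ l i t))
        rw [hb.polar.gauge_anglePoint] at hPs
        obtain ⟨e1, e2⟩ := hb.deriv_eq_of_support
          (a := fun t => cosOf (polarSet (Ω i)) (polarAngle γ A θ₀ l i t))
          (b := fun t => sinOf (polarSet (Ω i)) (polarAngle γ A θ₀ l i t))
          (Filter.Eventually.of_forall fun s => hb.polar.gauge_anglePoint _) hP hPs
          d2.hasDerivAt d3.hasDerivAt
        rw [hcross] at e1 e2
        have hP1 : gauge (Ω i) P = 1 := by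
          refine le_antisymm (hb.mem_iff_gauge_le_one.1 hP) ?_
          have h1 := hb.dot_le_gauge_mul_gauge
            (anglePoint (polarSet (Ω i)) (polarAngle γ A θ₀ l i t)) P
          rwa [hPs, hb.polar.gauge_anglePoint, one_mul] at h1
        refine ⟨P, ?_, ?_, ?_, ?_⟩
        · refine (d2.hasDerivAt.const_mul (A i)).congr_deriv ?_
          rw [e1]; field_simp
        · refine (d3.hasDerivAt.const_mul (A i)).congr_deriv ?_
          rw [e2]; field_simp
        · have hPs' : cosOf (polarSet (Ω i)) (polarAngle γ A θ₀ l i t) * P.1 +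
            sinOf (polarSet (Ω i)) (polarAngle γ A θ₀ l i t) * P.2 = 1 := hPs
          simp only [hh, hg]
          linear_combination A i * l t i * hPs'
        · rw [gauge_smul_of_nonneg ((hU.mem_subdiff_iff.1 (hl t htc)).1.1 i), hP1, smul_eq_mul,
            mul_one]
    choose P hPh hPg hPs hPl using key
    have dx : ∀ i, HasDerivAt (fun s => x s i) (l t i * (P i).1) t := fun i => by
      refine hasDerivAt_congr_Icc ht (fun s hs => hx s hs i)
        ((((hPg i).sub_const (g 0 i)).const_mul γ).congr_deriv ?_)
      linear_combination l t i * (P i).1 * hγ2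
    have dy : ∀ i, HasDerivAt (fun s => y s i) (l t i * (P i).2) t := fun i => by
      refine hasDerivAt_congr_Icc ht (fun s hs => hy s hs i)
        ((((hPh i).const_sub (h 0 i)).const_mul γ).congr_deriv ?_)
      linear_combination l t i * (P i).2 * hγ2
    have hv : velocity x y t = (fun i => l t i * (P i).1, fun i => l t i * (P i).2) :=
      Prod.ext (funext fun i => (dx i).deriv) (funext fun i => (dy i).deriv)
    rw [hv]
    have hmax := hU.isMax_of_gauges_mem
      (w := (fun i => l t i * (P i).1, fun i => l t i * (P i).2)) (h := h t) (g := g t)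
      (funext fun i => hPl i) (hl t htc)
      (hU.polarGauges_mul_anglePoint hA fun i => polarAngle γ A θ₀ l i t) hPs
    refine ⟨hmax.1, fun i => ⟨dx i, dy i, hPh i, hPg i⟩, ?_, hmax.2⟩
    refine hasDerivAt_congr_Icc ht hz' (((((hasDerivAt_id t).const_mul
      (γ * supportFun (xiSet μ) A)).fun_add (HasDerivAt.fun_sum fun i _ =>
        ((hPh i).const_mul (g 0 i)).fun_sub ((hPg i).const_mul (h 0 i)))).const_mul
          (1 / 2)).congr_deriv ?_)
    rw [mul_one]
    congr 1
    refine sum_vertical_eq (hx t htc) (hy t htc) ?_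
    rw [Finset.sum_congr rfl fun i _ => hPs i]
    exact (hU.mem_subdiff_iff.1 (hl t htc)).2

theorem normalizedExtremal_of_eq_zero (hU : SphericalForm U Ω μ) (hT : 0 < T)
    (hA : ∀ i, 0 ≤ A i) (hA0 : A ≠ 0) (hlm : Measurable l)
    (hl : ∀ t ∈ Icc 0 T, l t ∈ subdiff (supportFun (xiSet μ)) A)
    {θ : ℝ → Fin n → ℝ} (hθm : Measurable θ)
    (hθ : ∀ i, 0 < A i → ∀ t ∈ Icc 0 T, Corresponds (Ω i) (θ t i) (θ₀ i))
    (hx : ∀ t ∈ Icc 0 T, ∀ i, x t i = ∫ τ in (0 : ℝ)..t, l τ i * cosOf (Ω i) (θ τ i))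
    (hy : ∀ t ∈ Icc 0 T, ∀ i, y t i = ∫ τ in (0 : ℝ)..t, l τ i * sinOf (Ω i) (θ τ i))
    (hz : ∀ t ∈ Icc 0 T, z t = (1 / 2) * ∫ τ in (0 : ℝ)..t, ∑ i,
      (x τ i * deriv (fun s => y s i) τ - deriv (fun s => x s i) τ * y τ i)) :
    NormalizedExtremal U T x y z 0
      (fun _ i => A i * cosOf (polarSet (Ω i)) (θ₀ i))
      (fun _ i => A i * sinOf (polarSet (Ω i)) (θ₀ i)) := by
  obtain ⟨M, hM⟩ := hU.exists_abs_le_of_mem_subdiff A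
  have hlmi : ∀ i, Measurable fun t => l t i := fun i => (measurable_pi_apply i).comp hlm
  have hθmi : ∀ i, Measurable fun t => θ t i := fun i => (measurable_pi_apply i).comp hθm
  choose C hC using fun i => isBounded_iff_forall_norm_le.1 (hU.isCompact i).isBounded
  have hpt : ∀ i s, ‖anglePoint (Ω i) s‖ ≤ C i := fun i s => hC i _ ((hU.body i).anglePoint_mem s)
  have hum : ∀ i, Measurable fun t => l t i * cosOf (Ω i) (θ t i) := fun i =>
    (hlmi i).mul ((hU.body i).continuous_cosOf.measurable.comp (hθmi i))
  have hvm : ∀ i, Measurable fun t => l t i * sinOf (Ω i) (θ t i) := fun i =>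
    (hlmi i).mul ((hU.body i).continuous_sinOf.measurable.comp (hθmi i))
  have hub : ∀ i, ∀ t ∈ Icc 0 T, |l t i * cosOf (Ω i) (θ t i)| ≤ M * C i := fun i t ht => by
    have h1 := hM _ (hl t ht) i
    rw [abs_mul]
    exact mul_le_mul h1 ((norm_fst_le _).trans (hpt i _)) (abs_nonneg _)
      ((abs_nonneg _).trans h1)
  have hvb : ∀ i, ∀ t ∈ Icc 0 T, |l t i * sinOf (Ω i) (θ t i)| ≤ M * C i := fun i t ht => by
    have h1 := hM _ (hl t ht) i
    rw [abs_mul]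
    exact mul_le_mul h1 ((norm_snd_le _).trans (hpt i _)) (abs_nonneg _)
      ((abs_nonneg _).trans h1)
  have hlx : ∀ i, LipOn T fun t => x t i := fun i =>
    (LipOn.integral hT.le (hum i) (hub i)).congr fun t ht => hx t ht i
  have hly : ∀ i, LipOn T fun t => y t i := fun i =>
    (LipOn.integral hT.le (hvm i) (hvb i)).congr fun t ht => hy t ht i
  -- Lipschitz primitives of x_i y_i' and y_i x_i' show that z is Lipschitz with the expected a.e.
  -- derivative, without checking integrability of the area form separately.
  choose α hαL hα0 hαd using fun i => (hly i).exists_primitive hT.le (hlx i) 0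
  choose β hβL hβ0 hβd using fun i => (hlx i).exists_primitive hT.le (hly i) 0
  have hlZ : LipOn T fun t => ∑ i, (α i t - β i t) :=
    LipOn.sum Finset.univ fun i => (hαL i).sub (hβL i)
  have hdZ : ∀ᵐ t ∂(volume.restrict (Icc 0 T)), HasDerivAt (fun t => ∑ i, (α i t - β i t))
      (∑ i, (x t i * deriv (fun s => y s i) t - deriv (fun s => x s i) t * y t i)) t := by
    filter_upwards [ae_all_iff.2 hαd, ae_all_iff.2 hβd] with t h1 h2
    refine HasDerivAt.fun_sum fun i _ => ((h1 i).fun_sub (h2 i)).congr_deriv ?_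
    rw [mul_comm (deriv _ _)]
  have hzZ : ∀ t ∈ Icc 0 T, z t = 1 / 2 * ∑ i, (α i t - β i t) := by
    intro t ht
    rw [hz t ht, hlZ.integral_eq_sub hdZ t ht]
    simp only [hα0, hβ0, sub_zero, Finset.sum_const_zero]
  have h00 : (0 : ℝ) ∈ Icc 0 T := ⟨le_rfl, hT.le⟩
  have hpg := hU.polarGauges_mul_anglePoint hA θ₀
  refine ⟨Or.inl rfl, fun i => ?_, fun i => ?_, ?_, hlx, hly, (hlZ.const_mul _).congr hzZ,
    fun i => LipOn.const _, fun i => LipOn.const _, fun _ t _ hc => hA0 ?_, ?_⟩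
  · rw [hx 0 h00, intervalIntegral.integral_same]
  · rw [hy 0 h00, intervalIntegral.integral_same]
  · rw [hz 0 h00, intervalIntegral.integral_same, mul_zero]
  · rw [← hpg, hc.1, hc.2]
    funext i
    exact (polarGauges_eq_zero_iff hU).2 ⟨rfl, rfl⟩
  · filter_upwards [ae_all_iff.2 fun i => ae_hasDerivAt_integral hT.le (hum i) (hub i),
      ae_all_iff.2 fun i => ae_hasDerivAt_integral hT.le (hvm i) (hvb i), hdZ, ae_mem_Ioo T]
      with t hu hv dz ht
    have htc := Ioo_subset_Icc_self ht
    have dx := fun i => hasDerivAt_congr_Icc ht (fun s hs => hx s hs i) (hu i)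
    have dy := fun i => hasDerivAt_congr_Icc ht (fun s hs => hy s hs i) (hv i)
    have hvel : velocity x y t =
        (fun i => l t i * cosOf (Ω i) (θ t i), fun i => l t i * sinOf (Ω i) (θ t i)) :=
      Prod.ext (funext fun i => (dx i).deriv) (funext fun i => (dy i).deriv)
    have hgl : gauges Ω (fun i => l t i * cosOf (Ω i) (θ t i),
        fun i => l t i * sinOf (Ω i) (θ t i)) = l t := funext fun i => by
      change gauge (Ω i) (l t i • anglePoint (Ω i) (θ t i)) = l t i
      rw [gauge_smul_of_nonneg ((hU.mem_subdiff_iff.1 (hl t htc)).1.1 i),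
        (hU.body i).gauge_anglePoint, smul_eq_mul, mul_one]
    have hmax := hU.isMax_of_gauges_mem hgl (hl t htc) hpg fun i => by
      rcases (hA i).eq_or_lt with hi | hi
      · rw [← hi]; ring
      · have hb := hU.body i
        obtain ⟨P, hP, hPs⟩ :=
          hb.exists_dot_eq_gauge_polar (anglePoint (polarSet (Ω i)) (θ₀ i))
        -- The correspondence, tested at a point where the covector attains the value 1, bounds the
        -- pairing below by 1; polarity bounds it above.
        have h1 := hθ i hi t htc P hP
        have h2 := hb.dot_le_gauge_polar (hb.anglePoint_mem (θ t i))
          (anglePoint (polarSet (Ω i)) (θ₀ i))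
        rw [hb.polar.gauge_anglePoint] at h2 hPs
        have h3 : cosOf (polarSet (Ω i)) (θ₀ i) * cosOf (Ω i) (θ t i) +
            sinOf (polarSet (Ω i)) (θ₀ i) * sinOf (Ω i) (θ t i) = 1 :=
          le_antisymm h2 (hPs.symm.le.trans h1)
        linear_combination A i * l t i * h3
    rw [hvel]
    refine ⟨hmax.1, fun i => ⟨dx i, dy i, ?_, ?_⟩, ?_, hmax.2⟩
    · exact (hasDerivAt_const t _).congr_deriv (by ring)
    · exact (hasDerivAt_const t _).congr_deriv (by ring)
    · refine hasDerivAt_congr_Icc ht hzZ ((dz.const_mul (1 / 2)).congr_deriv ?_)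
      congr 1
      refine Finset.sum_congr rfl fun i _ => ?_
      rw [(dx i).deriv, (dy i).deriv, mul_comm (y t i)]

end SphericalForm

end SubFinsler

/-! ### The characterization of extremals -/

theorem theorem1 {n : ℕ} (U : Set (HVec n)) (Ω : Fin n → Set (ℝ × ℝ)) (μ : (Fin n → ℝ) → ℝ)
    (hU : SphericalForm U Ω μ) (T : ℝ) (hT : 0 < T)
    (x y : ℝ → Fin n → ℝ) (z : ℝ → ℝ) :
    IsExtremal U T (fun t => (x t, y t, z t)) ↔
      ∃ (γ : ℝ) (A θ₀ : Fin n → ℝ) (l : ℝ → Fin n → ℝ),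
        (γ = 0 ∨ γ = 1 ∨ γ = -1) ∧ (∀ i, 0 ≤ A i) ∧ ¬(γ = 0 ∧ A = 0) ∧
        Measurable l ∧ (∀ t ∈ Set.Icc 0 T, l t ∈ subdiff (supportFun (xiSet μ)) A) ∧
        (∀ i, A i = 0 ∧ γ ≠ 0 → ∀ t ∈ Set.Icc 0 T, l t i = 0) ∧
        (γ ≠ 0 → ∀ t ∈ Set.Icc 0 T,
          (∀ i, 0 < A i →
            x t i = γ * A i * (sinOf (polarSet (Ω i)) (polarAngle γ A θ₀ l i t)
              - sinOf (polarSet (Ω i)) (θ₀ i)) ∧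
            y t i = γ * A i * (cosOf (polarSet (Ω i)) (θ₀ i)
              - cosOf (polarSet (Ω i)) (polarAngle γ A θ₀ l i t))) ∧
          (∀ i, A i = 0 → x t i = 0 ∧ y t i = 0) ∧
          2 * z t = γ * supportFun (xiSet μ) A * t +
            ∑ i with 0 < A i, A i ^ 2 *
              (sinOf (polarSet (Ω i)) (θ₀ i) *
                  cosOf (polarSet (Ω i)) (polarAngle γ A θ₀ l i t)
                - cosOf (polarSet (Ω i)) (θ₀ i) *
                  sinOf (polarSet (Ω i)) (polarAngle γ A θ₀ l i t))) ∧
        (γ = 0 → ∃ θ : ℝ → Fin n → ℝ, Measurable θ ∧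
          (∀ i, 0 < A i → ∀ t ∈ Set.Icc 0 T, Corresponds (Ω i) (θ t i) (θ₀ i)) ∧
          ∀ t ∈ Set.Icc 0 T,
            (∀ i, x t i = ∫ τ in (0 : ℝ)..t, l τ i * cosOf (Ω i) (θ τ i)) ∧
            (∀ i, y t i = ∫ τ in (0 : ℝ)..t, l τ i * sinOf (Ω i) (θ τ i)) ∧
            z t = (1 / 2) * ∫ τ in (0 : ℝ)..t, ∑ i,
              (x τ i * deriv (fun s => y s i) τ - deriv (fun s => x s i) τ * y τ i)) := by
  constructor
  · intro hE
    obtain ⟨γ, h, g, hN⟩ := hE.exists_normalized hT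
    by_cases hγ : γ = 0
    · obtain ⟨A, θ₀, l, hA, hA0, hlm, hl, hθ⟩ := hN.parametrization_of_eq_zero hU hT hγ
      exact ⟨γ, A, θ₀, l, hN.vertical, hA, fun hc => hA0 hc.2, hlm, hl,
        fun _ hi => absurd hγ hi.2, fun hc => absurd hγ hc, fun _ => hθ⟩
    · obtain ⟨A, θ₀, l, hA, hlm, hl, hl0, hq⟩ := hN.parametrization_of_ne_zero hU hT hγ
      exact ⟨γ, A, θ₀, l, hN.vertical, hA, fun hc => hγ hc.1, hlm, hl, hl0, fun _ => hq,
        fun hc => absurd hc hγ⟩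
  · rintro ⟨γ, A, θ₀, l, hγ, hA, hγA, hlm, hl, hl0, hne, heq⟩
    by_cases hγ0 : γ = 0
    · obtain ⟨θ, hθm, hθ, hq⟩ := heq hγ0
      exact (hU.normalizedExtremal_of_eq_zero hT hA (fun hc => hγA ⟨hγ0, hc⟩) hlm hl hθm hθ
        (fun t ht => (hq t ht).1) (fun t ht => (hq t ht).2.1)
        (fun t ht => (hq t ht).2.2)).isExtremal hU.measurableSet hU.zero_mem_set
    · have hq := hne hγ0
      exact (hU.normalizedExtremal_of_ne_zero hT (hγ.resolve_left hγ0) hA hlm hl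
        (fun i hi => hl0 i ⟨hi, hγ0⟩) (fun t ht => (hq t ht).1) (fun t ht => (hq t ht).2.1)
        (fun t ht => (hq t ht).2.2)).isExtremal hU.measurableSet hU.zero_mem_set
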